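/- **Setting.** Let $1\le n\le N$ be integers and put $M=N-n$. Let $w:\mathbb R\to\mathbb R$ be a weight function whose moments $\mathfrak m_p=\int_{\mathbb R}z^pw(z)\,dz$ converge absolutely for $0\le p\le 2N-2$. Let $P_0,\dots,P_{N-1}$ be its monic orthogonal polynomials: $P_j$ is monic of degree $j$, $\int P_jP_kw\,dz=0$ for $j\ne k$, and $h_j=\int P_j(z)^2w(z)\,dz\neq0$ for $j<N$ (the last condition holds automatically if $w\ge 0$ and $w$ is not almost everywhere zero). Write $\Delta_m(z)=\prod_{1\le i<j\le m}(z_i-z_j)$ and $$K_N(a;b)=\sum_{j=0}^{N-1}\frac{P_j(a)P_j(b)}{h_j},\qquad K^{(n)}_N(x;y)=\frac{\det_{1\le i,j\le n}K_N(x_i;y_j)}{\Delta_n(x)\Delta_n(y)},\qquad \widehat K^{(n)}_N(x;y)=\frac{\prod_{j=N-n}^{N-1}h_j}{\prod_{i=1}^n(x_iy_i)^{N-n}}\,K^{(n)}_N(x;y),$$ where $K^{(n)}_N$ is a polynomial in $x,y\in\mathbb C^n$, so it is defined also when some of the $x_i$, or some of the $y_i$, coincide. Let $x^\vee=(-1/x_1,\dots,-1/x_n)$,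 and similarly $y^\vee$. Let $\mathbb Y_{n,M}$ be the set of partitions with at most $n$ nonzero parts and largest part at most $M$; let $\lambda'$ be the transpose and $|\lambda|$ the size of $\lambda$, and $s_\lambda$ the Schur polynomial. For functions $f$ of $z\in\mathbb R^M$ put $$\langle f\rangle_w=\frac1{M!\,\mathcal Z_M}\int_{\mathbb R^M}f(z)\,\Delta_M(z)^2\prod_{j=1}^Mw(z_j)\,dz_j,\qquad \mathcal Z_M=\frac1{M!}\int_{\mathbb R^M}\Delta_M(z)^2\prod_{j=1}^Mw(z_j)\,dz_j .$$ **Theorem.** $\mathcal Z_M\ne0$, the integrals defining $\langle s_{\lambda'}s_{\mu'}\rangle_w$ converge absolutely for all $\lambda,\mu\in\mathbb Y_{n,M}$, and for all $x,y\in(\mathbb C\setminus\{0\})^n$ $$\widehat K^{(n)}_N(x_1,\dots,x_n;y_1,\dots,y_n)=\sum_{\lambda,\mu\in\mathbb Y_{n,N-n}}s_\lambda(x^\vee)\,s_\mu(y^\vee)\,\langle s_{\lambda'}s_{\mu'}\rangle_w .$$ Moreover, for all $\lambda,\mu\in\mathbb Y_{n,M}$ the coefficients are normalized Hankel minors, $$\langle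 s_{\lambda'}s_{\mu'}\rangle_w=\frac{\det_{1\le j,k\le M}\big[\mathfrak m_{\lambda'_j+M-j+\mu'_k+M-k}\big]}{\det_{1\le j,k\le M}\big[\mathfrak m_{j+k-2}\big]},$$ and, in the equivalent form in terms of Hankel minors and Schur polynomials of the original variables, for all $x,y\in\mathbb C^n$ $$K^{(n)}_N(x;y)=\frac1{\det_{1\le j,k\le N}[\mathfrak m_{j+k-2}]}\sum_{\lambda,\mu\in\mathbb Y_{n,M}}(-1)^{|\lambda|+|\mu|}\,s_\lambda(x)\,s_\mu(y)\,\det_{1\le j,k\le M}\big[\mathfrak m_{(n+j-1-\lambda'_j)+(n+k-1-\mu'_k)}\big].$$ -/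

import Mathlib

/-! ### Partitions contained in a rectangle

Partitions are Young diagrams: with rows indexed from `0`, the part `λ_{i+1}` is `lam.rowLen i`, the
length `ℓ(λ)` is `lam.colLen 0`, and the transposed partition is `lam.transpose`. -/

theorem finite_boxPartitions (L M : ℕ) :
    {lam : YoungDiagram | lam.colLen 0 ≤ L ∧ lam.rowLen 0 ≤ M}.Finite := by
  refine Set.Finite.of_finite_image (f := YoungDiagram.cells) ?_
    (fun a _ b _ h => YoungDiagram.ext h)
  refine (Finset.finite_toSet (Finset.range L ×ˢ Finset.range M).powerset).subset ?_
  rintro _ ⟨lam, ⟨hL, hM⟩, rfl⟩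
  simp only [Finset.coe_powerset, Set.mem_preimage, Set.mem_powerset_iff, Finset.coe_subset]
  rintro ⟨i, j⟩ hij
  have hij' : (i, j) ∈ lam := hij
  have h1 := YoungDiagram.mem_iff_lt_colLen.1 (lam.up_left_mem le_rfl (Nat.zero_le j) hij')
  have h2 := YoungDiagram.mem_iff_lt_rowLen.1 (lam.up_left_mem (Nat.zero_le i) le_rfl hij')
  simp only [Finset.mem_product, Finset.mem_range]
  omega

/-- The finite set `𝕐_{L,M}` of the partitions `λ` with `ℓ(λ) ≤ L` and `λ₁ ≤ M`. -/
noncomputable def boxPartitions (L M : ℕ) : Finset YoungDiagram :=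
  (finite_boxPartitions L M).toFinset

/-! ### Vandermonde products and Schur polynomials -/

/-- The Vandermonde product `Δ_n(z) = ∏_{i<j} (z_i - z_j)`. -/
def vandermondeProd {A : Type*} [CommRing A] {n : ℕ} (z : Fin n → A) : A :=
  ∏ i, ∏ j ∈ Finset.Ioi i, (z i - z j)

/-- A matrix of values of polynomials in one variable at points `z_i` factors through a square matrix
of determinant `Δ_n(z)`. -/
theorem exists_factor_vandermondeProd {A ι : Type*} [CommRing A] {n : ℕ}
    (z : Fin n → A) (f : ι → Polynomial A) :
    ∃ (V : Matrix (Fin n) (Fin n) A) (G : Matrix (Fin n) ι A), V.det = vandermondeProd z ∧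
      (Matrix.of fun i k => (f k).eval (z i)) = V * G := by
  nontriviality A
  set q : Polynomial A := ∏ i, (Polynomial.X - Polynomial.C (-z i)) with hq
  have hqm : q.Monic := Polynomial.monic_prod_of_monic _ _ fun i _ => Polynomial.monic_X_sub_C _
  have hqd : q.natDegree = n := by
    rw [hq, Polynomial.natDegree_prod_of_monic _ _ fun i _ => Polynomial.monic_X_sub_C _]
    simp
  refine ⟨Matrix.vandermonde fun i => -z i,
    Matrix.of fun m k => (((f k).comp (-Polynomial.X)) %ₘ q).coeff m, ?_, ?_⟩
  · rw [Matrix.det_vandermonde, vandermondeProd]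
    exact Finset.prod_congr rfl fun i _ => Finset.prod_congr rfl fun j _ => by ring
  · ext i k
    have hroot : q.eval (-z i) = 0 := by
      rw [hq, Polynomial.eval_prod]
      exact Finset.prod_eq_zero (Finset.mem_univ i) (by simp)
    have h1 : (((f k).comp (-Polynomial.X)) %ₘ q).eval (-z i) = (f k).eval (z i) := by
      rw [Polynomial.modByMonic_eq_sub_mul_div]
      simp [hroot]
    have hdeg : (((f k).comp (-Polynomial.X)) %ₘ q).degree < n := by
      have h := Polynomial.degree_modByMonic_lt ((f k).comp (-Polynomial.X)) hqm
      rwa [Polynomial.degree_eq_natDegree hqm.ne_zero, hqd] at h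
    simp only [Matrix.of_apply, Matrix.mul_apply, Matrix.vandermonde_apply]
    rw [← h1, Polynomial.eval_eq_sum,
      ← Polynomial.sum_fin (fun e a => a * (-z i) ^ e) (by simp) hdeg]
    exact Finset.sum_congr rfl fun m _ => mul_comm _ _

/-- The alternant `a_{λ+δ}(z) = det (z_i ^ (λ_j + n - j))_{1 ≤ i, j ≤ n}`. -/
def alternant {A : Type*} [CommRing A] {n : ℕ} (lam : YoungDiagram) (z : Fin n → A) : A :=
  (Matrix.of fun i j : Fin n => z i ^ (lam.rowLen j + (n - 1 - j))).det

theorem vandermondeProd_dvd_alternant (n : ℕ) (lam : YoungDiagram) :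
    vandermondeProd (MvPolynomial.X : Fin n → MvPolynomial (Fin n) ℤ) ∣
      alternant lam (MvPolynomial.X : Fin n → MvPolynomial (Fin n) ℤ) := by
  obtain ⟨V, G, hV, hG⟩ := exists_factor_vandermondeProd
    (MvPolynomial.X : Fin n → MvPolynomial (Fin n) ℤ)
    (fun j : Fin n => Polynomial.X ^ (lam.rowLen j + (n - 1 - j)))
  simp only [Polynomial.eval_pow, Polynomial.eval_X] at hG
  exact ⟨G.det, by rw [alternant, hG, Matrix.det_mul, hV]⟩

/-- The Schur polynomial `s_λ` in `n` variables: the polynomial quotient of the alternant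
`a_{λ+δ}` by the Vandermonde product `a_δ = Δ_n` if `ℓ(λ) ≤ n`, and `0` if `ℓ(λ) > n`. -/
noncomputable def schurPoly (n : ℕ) (lam : YoungDiagram) : MvPolynomial (Fin n) ℤ :=
  if lam.colLen 0 ≤ n then (vandermondeProd_dvd_alternant n lam).choose else 0

theorem vandermondeProd_mul_schurPoly (n : ℕ) (lam : YoungDiagram) (h : lam.colLen 0 ≤ n) :
    vandermondeProd (MvPolynomial.X : Fin n → MvPolynomial (Fin n) ℤ) * schurPoly n lam =
      alternant lam (MvPolynomial.X : Fin n → MvPolynomial (Fin n) ℤ) := by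
  rw [schurPoly, if_pos h]
  exact (vandermondeProd_dvd_alternant n lam).choose_spec.symm

/-- The value `s_λ(z_1, …, z_n)`. -/
noncomputable def schur {A : Type*} [CommRing A] {n : ℕ} (lam : YoungDiagram) (z : Fin n → A) : A :=
  MvPolynomial.aeval z (schurPoly n lam)

/-! ### Orthogonal polynomials and Christoffel–Darboux kernels -/

/-- The bilinear form `⟨p, q⟩_w = ∫ p(z) q(z) w(z) dz`. -/
noncomputable def weightInner (w : ℝ → ℝ) (p q : Polynomial ℝ) : ℝ :=
  ∫ z : ℝ, p.eval z * q.eval z * w z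

/-- `P_0, …, P_{N-1}` are the first `N` monic orthogonal polynomials of the weight `w`. -/
structure IsMonicOrthogonal (w : ℝ → ℝ) (N : ℕ) (P : ℕ → Polynomial ℝ) : Prop where
  monic : ∀ j < N, (P j).Monic
  natDegree_eq : ∀ j < N, (P j).natDegree = j
  orthogonal : ∀ j < N, ∀ k < N, j ≠ k → weightInner w (P j) (P k) = 0

/-- The kernel `K_N(a; b) = ∑_{j<N} P_j(a) P_j(b) / h_j` with `h_j = ⟨P_j, P_j⟩_w`, for `a`, `b` in
any commutative real algebra (the numbers, or formal variables). -/
noncomputable def cdKernel (w : ℝ → ℝ) (P : ℕ → Polynomial ℝ) (N : ℕ)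
    {A : Type*} [CommRing A] [Algebra ℝ A] (a b : A) : A :=
  ∑ j ∈ Finset.range N, (weightInner w (P j) (P j))⁻¹ •
    (Polynomial.aeval a (P j) * Polynomial.aeval b (P j))

theorem vandermondeProd_dvd_det_cdKernel (w : ℝ → ℝ) (P : ℕ → Polynomial ℝ) (N : ℕ)
    {A : Type*} [CommRing A] [Algebra ℝ A] {n : ℕ} (x y : Fin n → A) :
    vandermondeProd x * vandermondeProd y ∣
      (Matrix.of fun i j : Fin n => cdKernel w P N (x i) (y j)).det := by
  obtain ⟨V, G, hV, hG⟩ := exists_factor_vandermondeProd x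
    (fun k : Fin N => (P k).map (algebraMap ℝ A))
  obtain ⟨V', G', hV', hG'⟩ := exists_factor_vandermondeProd y
    (fun k : Fin N => (P k).map (algebraMap ℝ A))
  simp only [Polynomial.eval_map_algebraMap] at hG hG'
  have key : (Matrix.of fun i j : Fin n => cdKernel w P N (x i) (y j)) =
      V * (G * Matrix.diagonal (fun k : Fin N =>
        algebraMap ℝ A (weightInner w (P k) (P k))⁻¹) * G'.transpose) * V'.transpose := by
    have : V * (G * Matrix.diagonal (fun k : Fin N =>
        algebraMap ℝ A (weightInner w (P k) (P k))⁻¹) * G'.transpose) * V'.transpose =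
        (V * G) * Matrix.diagonal (fun k : Fin N =>
        algebraMap ℝ A (weightInner w (P k) (P k))⁻¹) * (V' * G').transpose := by
      simp only [Matrix.transpose_mul, Matrix.mul_assoc]
    rw [this, ← hG, ← hG']
    ext i j
    rw [Matrix.mul_apply]
    simp only [Matrix.mul_diagonal, Matrix.of_apply, Matrix.transpose_apply, cdKernel]
    rw [Finset.sum_range]
    exact Finset.sum_congr rfl fun k _ => by rw [Algebra.smul_def]; ring
  refine ⟨(G * Matrix.diagonal (fun k : Fin N =>
        algebraMap ℝ A (weightInner w (P k) (P k))⁻¹) * G'.transpose).det, ?_⟩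
  rw [key, Matrix.det_mul, Matrix.det_mul, Matrix.det_transpose, hV, hV']
  ring

/-- The multi-point kernel as a polynomial in the formal variables `x_1, …, x_n; y_1, …, y_n`: the
exact quotient of `det (K_N(x_i; y_j))` by `Δ_n(x) Δ_n(y)`. -/
noncomputable def multiKernelPoly (w : ℝ → ℝ) (P : ℕ → Polynomial ℝ) (N n : ℕ) :
    MvPolynomial (Fin n ⊕ Fin n) ℝ :=
  (vandermondeProd_dvd_det_cdKernel w P N
    (fun i : Fin n => (MvPolynomial.X (Sum.inl i) : MvPolynomial (Fin n ⊕ Fin n) ℝ))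
    (fun j : Fin n => MvPolynomial.X (Sum.inr j))).choose

/-- The `2n`-point kernel `K_N^{(n)}(x_1, …, x_n; y_1, …, y_n)`, that is
`det (K_N(x_i; y_j)) / (Δ_n(x) Δ_n(y))`, extended polynomially to coinciding `x`'s or `y`'s. -/
noncomputable def multiKernel (w : ℝ → ℝ) (P : ℕ → Polynomial ℝ) (N : ℕ) {n : ℕ}
    (x y : Fin n → ℂ) : ℂ :=
  MvPolynomial.aeval (Sum.elim x y) (multiKernelPoly w P N n)

theorem map_vandermondeProd {A B : Type*} [CommRing A] [CommRing B] (φ : A →+* B) {n : ℕ}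
    (z : Fin n → A) : φ (vandermondeProd z) = vandermondeProd fun i => φ (z i) := by
  simp [vandermondeProd, map_prod]

theorem multiKernel_eq_div (w : ℝ → ℝ) (P : ℕ → Polynomial ℝ) (N : ℕ) {n : ℕ}
    (x y : Fin n → ℂ) (hx : Function.Injective x) (hy : Function.Injective y) :
    multiKernel w P N x y = 1 / (vandermondeProd x * vandermondeProd y) *
      (Matrix.of fun i j : Fin n => cdKernel w P N (x i) (y j)).det := by
  have hne : ∀ z : Fin n → ℂ, Function.Injective z → vandermondeProd z ≠ 0 := fun z hz =>
    Finset.prod_ne_zero_iff.2 fun i _ => Finset.prod_ne_zero_iff.2 fun j hj =>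
      sub_ne_zero.2 fun h => (Finset.mem_Ioi.1 hj).ne (hz h)
  have h := congrArg (MvPolynomial.aeval (Sum.elim x y) : MvPolynomial (Fin n ⊕ Fin n) ℝ →ₐ[ℝ] ℂ)
    (vandermondeProd_dvd_det_cdKernel w P N
      (fun i : Fin n => (MvPolynomial.X (Sum.inl i) : MvPolynomial (Fin n ⊕ Fin n) ℝ))
      (fun j : Fin n => MvPolynomial.X (Sum.inr j))).choose_spec
  rw [map_mul, map_mul, AlgHom.map_det] at h
  have hv : ∀ f : Fin n → MvPolynomial (Fin n ⊕ Fin n) ℝ,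
      (MvPolynomial.aeval (Sum.elim x y) : MvPolynomial (Fin n ⊕ Fin n) ℝ →ₐ[ℝ] ℂ)
        (vandermondeProd f) = vandermondeProd fun i => MvPolynomial.aeval (Sum.elim x y) (f i) :=
    fun f => map_vandermondeProd
      (MvPolynomial.aeval (Sum.elim x y) : MvPolynomial (Fin n ⊕ Fin n) ℝ →ₐ[ℝ] ℂ).toRingHom f
  have hm : (MvPolynomial.aeval (Sum.elim x y) :
        MvPolynomial (Fin n ⊕ Fin n) ℝ →ₐ[ℝ] ℂ).mapMatrix
      (Matrix.of fun i j : Fin n => cdKernel w P N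
        (MvPolynomial.X (Sum.inl i) : MvPolynomial (Fin n ⊕ Fin n) ℝ)
        (MvPolynomial.X (Sum.inr j))) =
      Matrix.of fun i j : Fin n => cdKernel w P N (x i) (y j) := by
    ext i j
    simp [cdKernel, ← Polynomial.aeval_algHom_apply]
  rw [hv, hv, hm] at h
  simp only [MvPolynomial.aeval_X, Sum.elim_inl, Sum.elim_inr] at h
  rw [h, multiKernel, multiKernelPoly]
  have h1 := hne x hx
  have h2 := hne y hy
  field_simp

/-- The normalized kernel
`K̂_N^{(n)}(x; y) = (∏_{j=N-n}^{N-1} h_j) / (∏_i (x_i y_i)^{N-n}) * K_N^{(n)}(x; y)`. -/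
noncomputable def normalizedKernel (w : ℝ → ℝ) (P : ℕ → Polynomial ℝ) (N : ℕ) {n : ℕ}
    (x y : Fin n → ℂ) : ℂ :=
  ((∏ j ∈ Finset.Ico (N - n) N, weightInner w (P j) (P j) : ℝ) : ℂ) /
    (∏ i, (x i * y i) ^ (N - n)) * multiKernel w P N x y

/-- The dual variables `x^∨ = (-1/x_1, …, -1/x_n)`. -/
noncomputable def dualVar {n : ℕ} (x : Fin n → ℂ) : Fin n → ℂ := fun i => -1 / x i

/-! ### Averages in the ensemble of `M` variables with weight `w` -/

/-- The density `Δ_M(z)^2 ∏_j w(z_j)` of the ensemble, before normalization. -/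
noncomputable def ensembleDensity (w : ℝ → ℝ) (M : ℕ) (z : Fin M → ℝ) : ℝ :=
  vandermondeProd z ^ 2 * ∏ j, w (z j)

/-- The partition function `𝒵_M = (1/M!) ∫ Δ_M(z)^2 ∏_j w(z_j) dz_j`. -/
noncomputable def partitionFunction (w : ℝ → ℝ) (M : ℕ) : ℝ :=
  1 / (M.factorial : ℝ) * ∫ z : Fin M → ℝ, ensembleDensity w M z

/-- The average `⟨f⟩_w = 𝒩_M ∫ f(z) Δ_M(z)^2 ∏_j w(z_j) dz_j` with `𝒩_M = 1 / (M! 𝒵_M)`. -/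
noncomputable def ensembleAverage (w : ℝ → ℝ) (M : ℕ) (f : (Fin M → ℝ) → ℝ) : ℝ :=
  1 / ((M.factorial : ℝ) * partitionFunction w M) *
    ∫ z : Fin M → ℝ, f z * ensembleDensity w M z

/-- The moment `𝔪_p = ∫ z^p w(z) dz`. -/
noncomputable def moment (w : ℝ → ℝ) (p : ℕ) : ℝ := ∫ z : ℝ, z ^ p * w z

/-- The Hankel determinant `det (𝔪_{i+j})_{0 ≤ i, j < N}`. -/
noncomputable def hankelDet (w : ℝ → ℝ) (N : ℕ) : ℝ :=
  (Matrix.of fun i j : Fin N => moment w (i + j)).det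

/-!
The coefficients of the kernel `K_N(a; b)` in the monomials `a ^ k b ^ l` form the inverse of the
`N × N` Hankel matrix of moments: if `C` is the unitriangular matrix of the coefficients of the
`P_j`, orthogonality says `C H Cᵀ = diag(h_j)` (`coeffMatrix_mul_hankel_mul_transpose`), hence
`H⁻¹ = Cᵀ diag(h_j)⁻¹ C` (`hankel_mul_cdCoeff`) and `det H = ∏ h_j` (`hankelDet_eq_prod`).

Two applications of the Cauchy–Binet formula therefore expand `det (K_N(x_i; y_j))` over pairs of
`n`-subsets of `{0, …, N - 1}`. Such a subset is the set `{λ_i + n - i}` of a unique partition `λ` in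
the `n × M` rectangle, where `M = N - n`, and then the minor in `x` is the alternant of `λ`, that is
`Δ_n(x) s_λ(x)` (`det_sum_mul_eq_sum_boxPartitions`). The complementary subset is
`{n + j - 1 - λ'_j}`, and the inversions between the two are the cells of `λ`. So Jacobi's
complementary minor formula turns the minors of `H⁻¹` into Hankel minors with the sign
`(-1) ^ (|λ| + |μ|)` (`det_mul_minor_shiftedPart`). Cancelling the Vandermonde products in the ring of
polynomials gives the expansion in the original variables, at all points
(`hankelDet_mul_multiKernel`).

Replacing each partition by its complement in the rectangle changes `s_λ(x)` into
`± ∏ x_i ^ M s_λ(-1/x)` (`prod_pow_mul_schur_boxComplement`) and `n + j - 1 - λ'_j` into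
`λ'_j + M - j`, up to the order of the indices `j`. The resulting Hankel minors are `det H_M` times the averages of `s_λ' s_μ'` by
Andréief's identity (`integral_det_mul_det_mul_prod`), since `s_λ'(z) Δ_M(z)` is an alternant. This is
the expansion in the dual variables.
-/

/-! ### Two determinant formulas -/

open Matrix Finset in
/-- The **Cauchy–Binet formula**, summed over the order embeddings of `Fin n` into the index set. -/
theorem Matrix.det_mul_eq_sum_orderEmbedding {R ι : Type*} [CommRing R] [Fintype ι]
    [LinearOrder ι] {n : ℕ} (A : Matrix (Fin n) ι R) (B : Matrix ι (Fin n) R) :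
    (A * B).det = ∑ g : Fin n ↪o ι, (A.submatrix id g).det * (B.submatrix g id).det := by
  have h1 : (A * B).det = ∑ f : Fin n → ι, (∏ i, A i (f i)) * (B.submatrix f id).det := by
    have h := (detRowAlternating (n := Fin n) (R := R)).toMultilinearMap.map_sum
      (fun (i : Fin n) (k : ι) => A i k • B k)
    have h2 : A * B = fun i => ∑ k, A i k • B k := by
      ext i j
      simp [mul_apply]
    rw [h2]
    refine h.trans (Finset.sum_congr rfl fun f _ => ?_)
    exact (detRowAlternating (n := Fin n) (R := R)).toMultilinearMap.map_smul_univ _ _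
  have h2 : ∀ (g : Fin n ↪o ι), (A.submatrix id g).det * (B.submatrix g id).det =
      ∑ σ : Equiv.Perm (Fin n), (∏ i, A i (g (σ i))) * (B.submatrix (g ∘ σ) id).det := by
    intro g
    have h3 : ∀ σ : Equiv.Perm (Fin n), (B.submatrix (g ∘ σ) id).det =
        Equiv.Perm.sign σ * (B.submatrix g id).det := fun σ =>
      det_permute σ (B.submatrix g id)
    rw [← det_transpose, det_apply', Finset.sum_mul]
    refine Finset.sum_congr rfl fun σ _ => ?_
    rw [h3]
    simp only [transpose_apply, submatrix_apply, id]
    ring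
  simp only [h1, h2]
  rw [← Fintype.sum_prod_type']
  symm
  refine Finset.sum_of_injOn (fun p : (Fin n ↪o ι) × Equiv.Perm (Fin n) => p.1 ∘ p.2) ?_ ?_ ?_ ?_
  · rintro ⟨g, σ⟩ - ⟨g', σ'⟩ - h
    have hr : Set.range g = Set.range g' := by
      rw [← σ.surjective.range_comp g, ← σ'.surjective.range_comp g']
      exact congrArg Set.range h
    have hg : g = g' := by
      apply DFunLike.coe_injective
      exact (StrictMono.range_inj g.strictMono g'.strictMono).1 hr
    subst hg
    have : σ = σ' := Equiv.ext fun i => g.injective (congrFun h i)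
    rw [this]
  · intro _ _
    simp
  · intro f _ hf
    -- A map outside the image is not injective, and repeats a row of `B`.
    have hinj : ¬ Function.Injective f := by
      intro hinj
      apply hf
      have hc : (Finset.univ.image f).card = n := by
        rw [Finset.card_image_of_injective _ hinj, Finset.card_fin]
      let g := (Finset.univ.image f).orderEmbOfFin hc
      have hm : ∀ i, ∃ j, g j = f i := by
        intro i
        have : f i ∈ Set.range g := by
          simp [g, Finset.range_orderEmbOfFin]
        exact this
      choose s hs using hm
      have hsi : Function.Injective s := fun a b hab => hinj (by rw [← hs a, ← hs b, hab])
      exact ⟨(g, Equiv.ofBijective s (Finite.injective_iff_bijective.1 hsi)), by simp,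
        funext hs⟩
    simp only [Function.Injective, not_forall] at hinj
    obtain ⟨a, b, hab, hne⟩ := hinj
    rw [det_zero_of_row_eq hne (by ext; simp [hab]), mul_zero]
  · rintro ⟨g, σ⟩ _
    rfl

/-- **Jacobi's complementary minor formula**: a minor of the inverse matrix, times the determinant,
is the complementary minor of the matrix, with the sign carried here by the reindexing. -/
theorem Matrix.det_mul_minor_inverse {R ι m p : Type*} [CommRing R] [Fintype ι] [DecidableEq ι]
    [Fintype m] [DecidableEq m] [Fintype p] [DecidableEq p]
    {A B : Matrix ι ι R} (h : A * B = 1) (e f : m ⊕ p ≃ ι) :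
    (A.submatrix f e).det * (B.submatrix (e ∘ Sum.inl) (f ∘ Sum.inl)).det =
      (A.submatrix (f ∘ Sum.inr) (e ∘ Sum.inr)).det := by
  have h1 : A.submatrix f e * B.submatrix e f = 1 := by
    rw [Matrix.submatrix_mul_equiv, h, Matrix.submatrix_one_equiv]
  set A' := A.submatrix f e with hA
  set B' := B.submatrix e f with hB
  -- Taking determinants in `A' * [B'₁₁, 0; B'₂₁, 1] = [1, A'₁₂; 0, A'₂₂]` gives the formula.
  have h2 : A' * Matrix.fromBlocks B'.toBlocks₁₁ 0 B'.toBlocks₂₁ 1 =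
      Matrix.fromBlocks 1 A'.toBlocks₁₂ 0 A'.toBlocks₂₂ := by
    have h3 := h1
    rw [← Matrix.fromBlocks_toBlocks A', ← Matrix.fromBlocks_toBlocks B',
      Matrix.fromBlocks_multiply, ← Matrix.fromBlocks_one] at h3
    have h4 := Matrix.fromBlocks_inj.1 h3
    conv_lhs => rw [← Matrix.fromBlocks_toBlocks A', Matrix.fromBlocks_multiply]
    simp only [h4.1, h4.2.2.1, Matrix.mul_zero, Matrix.mul_one, zero_add]
  have h3 := congrArg Matrix.det h2
  rw [Matrix.det_mul, Matrix.det_fromBlocks_zero₁₂, Matrix.det_fromBlocks_zero₂₁,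
    Matrix.det_one, Matrix.det_one, mul_one, one_mul] at h3
  exact h3

/-! ### Partitions in a rectangle and complementary sets of shifted parts -/

theorem mem_boxPartitions {L M : ℕ} {lam : YoungDiagram} :
    lam ∈ boxPartitions L M ↔ lam.colLen 0 ≤ L ∧ lam.rowLen 0 ≤ M := by
  simp [boxPartitions]

theorem mem_boxPartitions_iff_forall {L M : ℕ} {lam : YoungDiagram} :
    lam ∈ boxPartitions L M ↔ ∀ i j, (i, j) ∈ lam → i < L ∧ j < M := by
  rw [mem_boxPartitions]
  constructor
  · rintro ⟨h1, h2⟩ i j h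
    have h3 := YoungDiagram.mem_iff_lt_colLen.1 (lam.up_left_mem le_rfl (Nat.zero_le j) h)
    have h4 := YoungDiagram.mem_iff_lt_rowLen.1 (lam.up_left_mem (Nat.zero_le i) le_rfl h)
    omega
  · intro h
    constructor
    · by_contra hc
      have := (h L 0 (YoungDiagram.mem_iff_lt_colLen.2 (by omega))).1
      omega
    · by_contra hc
      have := (h 0 M (YoungDiagram.mem_iff_lt_rowLen.2 (by omega))).2
      omega

theorem rowLen_le_of_mem_boxPartitions {L M : ℕ} {lam : YoungDiagram}
    (h : lam ∈ boxPartitions L M) (i : ℕ) : lam.rowLen i ≤ M :=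
  (lam.rowLen_anti 0 i (Nat.zero_le i)).trans (mem_boxPartitions.1 h).2

theorem rowLen_eq_zero_of_mem_boxPartitions {L M : ℕ} {lam : YoungDiagram}
    (h : lam ∈ boxPartitions L M) {i : ℕ} (hi : L ≤ i) : lam.rowLen i = 0 := by
  by_contra hc
  have := (mem_boxPartitions_iff_forall.1 h i 0
    (YoungDiagram.mem_iff_lt_rowLen.2 (by omega))).1
  omega

theorem transpose_mem_boxPartitions {L M : ℕ} {lam : YoungDiagram}
    (h : lam ∈ boxPartitions L M) : lam.transpose ∈ boxPartitions M L := by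
  rw [mem_boxPartitions] at h ⊢
  rw [YoungDiagram.colLen_transpose, YoungDiagram.rowLen_transpose]
  exact h.symm

/-- The shifted part `λ_i + n - i` (for `i` from `1`) of `λ`, an exponent of the alternant of `λ` in
`n` variables. With `i` counted from `0` it is `λ_{i+1} + (n - 1 - i)`; it is used for `i < n` only,
where the subtraction is not truncated. -/
def shiftedPart (n : ℕ) (lam : YoungDiagram) (i : ℕ) : ℕ := lam.rowLen i + (n - 1 - i)

/-- The number `n + j - 1 - λ'_j` (for `j` from `1`), here with `j` counted from `0`. When `ℓ(λ) ≤ n`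
the subtraction is not truncated, and for `j` up to `M` these numbers form the complement in
`{0, …, n + M - 1}` of the shifted parts of a partition in the `n × M` rectangle. -/
def coshiftedPart (n : ℕ) (lam : YoungDiagram) (j : ℕ) : ℕ := n + j - lam.transpose.rowLen j

/-- The cells of `λ` are the inversions between its two sequences of shifted parts. -/
theorem coshiftedPart_lt_shiftedPart_iff {n i j : ℕ} (lam : YoungDiagram)
    (hl : lam.colLen 0 ≤ n) (hi : i < n) :
    coshiftedPart n lam j < shiftedPart n lam i ↔ (i, j) ∈ lam := by
  have h1 := @YoungDiagram.mem_iff_lt_rowLen lam i j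
  have h2 := @YoungDiagram.mem_iff_lt_colLen lam i j
  have h3 := lam.colLen_anti 0 j (Nat.zero_le j)
  rw [coshiftedPart, shiftedPart, YoungDiagram.rowLen_transpose]
  by_cases h : (i, j) ∈ lam
  · have := h1.1 h; have := h2.1 h
    simp only [h, iff_true]; omega
  · have := mt h1.2 h; have := mt h2.2 h
    simp only [h, iff_false]; omega

theorem coshiftedPart_ne_shiftedPart {n i j : ℕ} (lam : YoungDiagram)
    (hl : lam.colLen 0 ≤ n) (hi : i < n) :
    coshiftedPart n lam j ≠ shiftedPart n lam i := by
  have h1 := @YoungDiagram.mem_iff_lt_rowLen lam i j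
  have h2 := @YoungDiagram.mem_iff_lt_colLen lam i j
  have h3 := lam.colLen_anti 0 j (Nat.zero_le j)
  rw [coshiftedPart, shiftedPart, YoungDiagram.rowLen_transpose]
  by_cases h : (i, j) ∈ lam
  · have := h1.1 h; have := h2.1 h
    omega
  · have := mt h1.2 h; have := mt h2.2 h
    omega

theorem shiftedPart_lt_shiftedPart {n i k : ℕ} (lam : YoungDiagram) (hik : i < k) (hk : k < n) :
    shiftedPart n lam k < shiftedPart n lam i := by
  have := lam.rowLen_anti i k hik.le
  simp only [shiftedPart]; omega

theorem coshiftedPart_lt_coshiftedPart {n j k : ℕ} (lam : YoungDiagram) (hl : lam.colLen 0 ≤ n)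
    (hjk : j < k) : coshiftedPart n lam j < coshiftedPart n lam k := by
  have h3 := lam.colLen_anti 0 j (Nat.zero_le j)
  have h4 := lam.colLen_anti j k hjk.le
  simp only [coshiftedPart, YoungDiagram.rowLen_transpose]; omega

theorem shiftedPart_lt {n M i : ℕ} {lam : YoungDiagram} (h : lam ∈ boxPartitions n M)
    (hi : i < n) : shiftedPart n lam i < n + M := by
  have := rowLen_le_of_mem_boxPartitions h i
  simp only [shiftedPart]; omega

theorem coshiftedPart_lt {n M j : ℕ} (lam : YoungDiagram) (hj : j < M) :
    coshiftedPart n lam j < n + M := by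
  simp only [coshiftedPart]; omega

/-- The splitting of `{0, …, n + M - 1}` into the two sequences of shifted parts of a partition in
the `n × M` rectangle. -/
noncomputable def shiftedPartsEquiv {n M : ℕ} {lam : YoungDiagram} (h : lam ∈ boxPartitions n M) :
    Fin n ⊕ Fin M ≃ Fin (n + M) :=
  Equiv.ofBijective
    (Sum.elim (fun i => ⟨shiftedPart n lam i, shiftedPart_lt h i.2⟩)
      (fun j => ⟨coshiftedPart n lam j, coshiftedPart_lt lam j.2⟩)) <| by
    have hl := (mem_boxPartitions.1 h).1
    rw [Fintype.bijective_iff_injective_and_card]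
    refine ⟨Function.Injective.sumElim ?_ ?_ ?_, by simp⟩
    · intro a b hab
      rcases lt_trichotomy a b with hlt | heq | hlt
      · exact absurd (Fin.ext_iff.1 hab) (shiftedPart_lt_shiftedPart lam hlt b.2).ne'
      · exact heq
      · exact absurd (Fin.ext_iff.1 hab) (shiftedPart_lt_shiftedPart lam hlt a.2).ne
    · intro a b hab
      rcases lt_trichotomy a b with hlt | heq | hlt
      · exact absurd (Fin.ext_iff.1 hab) (coshiftedPart_lt_coshiftedPart lam hl hlt).ne
      · exact heq
      · exact absurd (Fin.ext_iff.1 hab) (coshiftedPart_lt_coshiftedPart lam hl hlt).ne'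
    · intro a b hab
      exact coshiftedPart_ne_shiftedPart lam hl a.2 (Fin.ext_iff.1 hab).symm

theorem card_eq_card_filter_mem {n M : ℕ} {lam : YoungDiagram} (h : lam ∈ boxPartitions n M) :
    lam.card = (Finset.univ.filter fun p : Fin n × Fin M => ((p.1 : ℕ), (p.2 : ℕ)) ∈ lam).card := by
  symm
  refine Finset.card_bij (fun p _ => ((p.1 : ℕ), (p.2 : ℕ))) ?_ ?_ ?_
  · intro p hp
    simpa using hp
  · rintro ⟨a, b⟩ _ ⟨c, d⟩ _ hh
    simpa [Fin.ext_iff] using hh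
  · rintro ⟨i, j⟩ hij
    have hij' : (i, j) ∈ lam := hij
    obtain ⟨hi, hj⟩ := mem_boxPartitions_iff_forall.1 h i j hij'
    exact ⟨(⟨i, hi⟩, ⟨j, hj⟩), by simpa using hij', rfl⟩

/-- The sign of the splitting attached to `λ` is `(-1) ^ |λ|`, up to the sign of the reversal of
`Fin n`, which does not depend on `λ`. -/
theorem sign_shiftedPartsEquiv {n M : ℕ} {lam : YoungDiagram} (h : lam ∈ boxPartitions n M) :
    Equiv.Perm.sign (finSumFinEquiv.symm.trans (shiftedPartsEquiv h)) =
      (∏ i : Fin n, ∏ k : Fin n, if i < k then (-1 : ℤˣ) else 1) * (-1) ^ lam.card := by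
  have hl := (mem_boxPartitions.1 h).1
  rw [Equiv.Perm.sign_eq_prod_prod_Ioi]
  have hsplit : ∀ (σ : Equiv.Perm (Fin (n + M))) (i : Fin (n + M)),
      (∏ j ∈ Finset.Ioi i, if σ i < σ j then (1 : ℤˣ) else -1) =
      ∏ j, if i < j then (if σ i < σ j then (1 : ℤˣ) else -1) else 1 := by
    intro σ i
    rw [← Finset.prod_filter]
    congr 1
    ext j
    simp
  simp only [hsplit]
  rw [Fin.prod_univ_add]
  -- Two elements of the second block are never inverted, and nothing follows it.
  have h2 : ∀ j : Fin M, (∏ k, if Fin.natAdd n j < k then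
      (if (finSumFinEquiv.symm.trans (shiftedPartsEquiv h)) (Fin.natAdd n j) <
        (finSumFinEquiv.symm.trans (shiftedPartsEquiv h)) k then (1 : ℤˣ) else -1) else 1) = 1 := by
    intro j
    rw [Fin.prod_univ_add]
    have ha : ∀ k : Fin n, ¬ Fin.natAdd n j < Fin.castAdd M k := by
      intro k; simp only [Fin.lt_def, Fin.val_natAdd, Fin.val_castAdd]; omega
    have hb : ∀ k : Fin M, Fin.natAdd n j < Fin.natAdd n k →
        (finSumFinEquiv.symm.trans (shiftedPartsEquiv h)) (Fin.natAdd n j) <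
        (finSumFinEquiv.symm.trans (shiftedPartsEquiv h)) (Fin.natAdd n k) := by
      intro k hk
      simp only [Equiv.trans_apply, finSumFinEquiv_symm_apply_natAdd]
      have hk' : n + (j : ℕ) < n + k := hk
      exact coshiftedPart_lt_coshiftedPart lam hl (by omega)
    refine (congrArg₂ (· * ·) (Finset.prod_eq_one fun k _ => if_neg (ha k))
      (Finset.prod_eq_one fun k _ => ?_)).trans (mul_one 1)
    split_ifs with h1 h2
    · rfl
    · exact absurd (hb k h1) h2
    · rfl
  rw [Finset.prod_eq_one (s := Finset.univ (α := Fin M)) (fun j _ => h2 j), mul_one]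
  -- Two elements of the first block are always inverted; across the blocks, inversions are cells.
  have h3 : ∀ i : Fin n, (∏ k, if Fin.castAdd M i < k then
      (if (finSumFinEquiv.symm.trans (shiftedPartsEquiv h)) (Fin.castAdd M i) <
        (finSumFinEquiv.symm.trans (shiftedPartsEquiv h)) k then (1 : ℤˣ) else -1) else 1) =
      (∏ k : Fin n, if i < k then (-1 : ℤˣ) else 1) *
        ∏ j : Fin M, if ((i : ℕ), (j : ℕ)) ∈ lam then -1 else 1 := by
    intro i
    rw [Fin.prod_univ_add]
    refine congrArg₂ (· * ·) (Finset.prod_congr rfl fun k _ => ?_)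
      (Finset.prod_congr rfl fun j _ => ?_)
    · simp only [Equiv.trans_apply, finSumFinEquiv_symm_apply_castAdd]
      by_cases hik : i < k
      · have hik' : Fin.castAdd M i < Fin.castAdd M k := hik
        rw [if_pos hik', if_pos hik, if_neg]
        change ¬ shiftedPart n lam i < shiftedPart n lam k
        exact (shiftedPart_lt_shiftedPart lam hik k.2).le.not_gt
      · have hik' : ¬ Fin.castAdd M i < Fin.castAdd M k := hik
        rw [if_neg hik', if_neg hik]
    · have hlt : Fin.castAdd M i < Fin.natAdd n j := by
        simp only [Fin.lt_def, Fin.val_natAdd, Fin.val_castAdd]; omega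
      rw [if_pos hlt]
      simp only [Equiv.trans_apply, finSumFinEquiv_symm_apply_castAdd,
        finSumFinEquiv_symm_apply_natAdd]
      have hc := coshiftedPart_lt_shiftedPart_iff (j := (j : ℕ)) lam hl i.2
      have hne := coshiftedPart_ne_shiftedPart (j := (j : ℕ)) lam hl i.2
      have hiff : shiftedPartsEquiv h (Sum.inl i) < shiftedPartsEquiv h (Sum.inr j) ↔
          ¬ ((i : ℕ), (j : ℕ)) ∈ lam := by
        rw [← hc]
        change shiftedPart n lam i < coshiftedPart n lam j ↔ _
        omega
      by_cases hm : ((i : ℕ), (j : ℕ)) ∈ lam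
      · rw [if_pos hm, if_neg (by rw [hiff]; simpa using hm)]
      · rw [if_neg hm, if_pos (hiff.2 hm)]
  rw [Finset.prod_congr rfl fun i _ => h3 i, Finset.prod_mul_distrib, card_eq_card_filter_mem h,
    ← Finset.prod_const, Finset.prod_filter, Fintype.prod_prod_type]

/-! ### Minors indexed by partitions -/

/-- Jacobi's formula for the minors that two partitions in the `n × M` rectangle cut out of a pair
of inverse matrices. -/
theorem det_mul_minor_shiftedPart {R : Type*} [CommRing R] {n M : ℕ} {a b : ℕ → ℕ → R}
    (hab : (Matrix.of fun i j : Fin (n + M) => a i j) * (Matrix.of fun i j : Fin (n + M) => b i j)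
      = 1) {lam mu : YoungDiagram} (hl : lam ∈ boxPartitions n M) (hm : mu ∈ boxPartitions n M) :
    (Matrix.of fun i j : Fin (n + M) => a i j).det *
      (Matrix.of fun i j : Fin n => b (shiftedPart n lam i) (shiftedPart n mu j)).det =
    (-1) ^ (lam.card + mu.card) *
      (Matrix.of fun i j : Fin M => a (coshiftedPart n mu i) (coshiftedPart n lam j)).det := by
  have h1 := Matrix.det_mul_minor_inverse hab (shiftedPartsEquiv hl) (shiftedPartsEquiv hm)
  have h2 : ((Matrix.of fun i j : Fin (n + M) => a i j).submatrix (shiftedPartsEquiv hm)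
      (shiftedPartsEquiv hl)).det =
      (-1) ^ (lam.card + mu.card) * (Matrix.of fun i j : Fin (n + M) => a i j).det := by
    rw [← Matrix.det_submatrix_equiv_self finSumFinEquiv.symm, Matrix.submatrix_submatrix]
    change ((Matrix.of fun i j : Fin (n + M) => a i j).submatrix
      (finSumFinEquiv.symm.trans (shiftedPartsEquiv hm))
      (finSumFinEquiv.symm.trans (shiftedPartsEquiv hl))).det = _
    rw [← Function.id_comp (finSumFinEquiv.symm.trans (shiftedPartsEquiv hl) : _ → _),
      ← Function.comp_id (finSumFinEquiv.symm.trans (shiftedPartsEquiv hm) : _ → _),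
      ← Matrix.submatrix_submatrix, Matrix.det_permute', Matrix.det_permute,
      sign_shiftedPartsEquiv hl, sign_shiftedPartsEquiv hm, ← mul_assoc, ← Int.cast_mul,
      ← Units.val_mul, mul_mul_mul_comm, Int.units_mul_self, one_mul, ← pow_add]
    simp
  have h3 : ∀ {x y z : R}, (-1) ^ (lam.card + mu.card) * x * y = z →
      x * y = (-1) ^ (lam.card + mu.card) * z := by
    rintro x y z rfl
    rw [← mul_assoc, ← mul_assoc, ← pow_add, Even.neg_one_pow (by simp), one_mul]
  rw [h2] at h1
  exact h3 h1

/-- Every strictly decreasing sequence of length `n` in `{0, …, n + M - 1}` is the sequence of shifted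
parts of a partition in the `n × M` rectangle, with parts `s_i - (n - 1 - i)`. -/
theorem exists_shiftedPart_eq {n M : ℕ} (s : Fin n → ℕ) (hs : StrictAnti s)
    (hM : ∀ i, s i < n + M) :
    ∃ lam ∈ boxPartitions n M, ∀ i : Fin n, shiftedPart n lam i = s i := by
  -- A strictly decreasing sequence of integers drops by at least `k` over `k` steps.
  have hlow : ∀ k i : ℕ, ∀ hik : i + k < n, s ⟨i + k, hik⟩ + k ≤ s ⟨i, by omega⟩ := by
    intro k
    induction k with
    | zero => intro i hik; simp
    | succ k ih =>
      intro i hik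
      have h1 := ih i (by omega)
      have h2 : s ⟨i + (k + 1), hik⟩ < s ⟨i + k, by omega⟩ := hs (Fin.mk_lt_mk.2 (by omega))
      omega
  have hge : ∀ i : Fin n, n - 1 - i ≤ s i := by
    intro i
    have := hlow (n - 1 - i) i (by omega)
    simp only [Fin.eta] at this
    omega
  have hle : ∀ i : Fin n, s i ≤ M + (n - 1 - i) := by
    intro i
    have h1 := hlow i 0 (by omega)
    have h2 := hM ⟨0, by omega⟩
    simp only [zero_add, Fin.eta] at h1
    omega
  let lam : YoungDiagram :=
    { cells := (Finset.range n ×ˢ Finset.range M).filter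
        fun c => ∃ h : c.1 < n, c.2 + (n - 1 - c.1) < s ⟨c.1, h⟩
      isLowerSet := by
        rintro ⟨i, j⟩ ⟨i', j'⟩ hle h
        obtain ⟨hi, hj⟩ : i' ≤ i ∧ j' ≤ j := hle
        simp only [Finset.coe_filter, Finset.mem_product, Finset.mem_range, Set.mem_ofPred_eq]
          at h ⊢
        obtain ⟨⟨h1, h2⟩, h3, h4⟩ := h
        refine ⟨by omega, by omega, ?_⟩
        have h5 := hlow (i - i') i' (by omega)
        simp only [Nat.add_sub_cancel' hi] at h5
        omega }
  have hmem : ∀ i j, (i, j) ∈ lam ↔ (i < n ∧ j < M) ∧ ∃ h : i < n, j + (n - 1 - i) < s ⟨i, h⟩ := by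
    intro i j
    rw [← YoungDiagram.mem_cells]
    simp [lam]
  refine ⟨lam, mem_boxPartitions_iff_forall.2 fun i j h => ((hmem i j).1 h).1, fun i => ?_⟩
  have h1 : ∀ j, j < lam.rowLen i ↔ j < s i - (n - 1 - i) := by
    intro j
    rw [← YoungDiagram.mem_iff_lt_rowLen, hmem]
    have := hle i
    constructor
    · rintro ⟨-, _, h⟩
      simp only [Fin.eta] at h
      omega
    · intro h
      exact ⟨⟨i.2, by omega⟩, i.2, by simp only [Fin.eta]; omega⟩
  have h2 := (h1 (lam.rowLen i)).not.1 (lt_irrefl _)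
  have h3 := (h1 (s i - (n - 1 - i))).not.2 (lt_irrefl _)
  have := hge i
  rw [shiftedPart]
  omega

theorem eq_of_shiftedPart_eq {n M : ℕ} {lam mu : YoungDiagram} (hl : lam ∈ boxPartitions n M)
    (hm : mu ∈ boxPartitions n M)
    (h : ∀ i : Fin n, shiftedPart n lam i = shiftedPart n mu i) : lam = mu := by
  have h1 : ∀ i, lam.rowLen i = mu.rowLen i := by
    intro i
    by_cases hi : i < n
    · have := h ⟨i, hi⟩
      simp only [shiftedPart] at this
      omega
    · rw [rowLen_eq_zero_of_mem_boxPartitions hl (by omega),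
        rowLen_eq_zero_of_mem_boxPartitions hm (by omega)]
  ext ⟨i, j⟩
  rw [YoungDiagram.mem_cells, YoungDiagram.mem_cells, YoungDiagram.mem_iff_lt_rowLen,
    YoungDiagram.mem_iff_lt_rowLen, h1]

/-- The Cauchy–Binet formula, with the sets of `n` columns among `n + M` listed by the partitions in
the `n × M` rectangle through their shifted parts. -/
theorem det_sum_mul_eq_sum_boxPartitions {R : Type*} [CommRing R] {n M : ℕ}
    (a : Fin n → ℕ → R) (b : ℕ → Fin n → R) :
    (Matrix.of fun i j => ∑ k ∈ Finset.range (n + M), a i k * b k j).det =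
      ∑ lam ∈ boxPartitions n M, (Matrix.of fun i j : Fin n => a i (shiftedPart n lam j)).det *
        (Matrix.of fun i j : Fin n => b (shiftedPart n lam i) j).det := by
  have h1 : (Matrix.of fun i j => ∑ k ∈ Finset.range (n + M), a i k * b k j) =
      (Matrix.of fun (i : Fin n) (k : Fin (n + M)) => a i k) *
        (Matrix.of fun (k : Fin (n + M)) (j : Fin n) => b k j) := by
    ext i j
    simp [Matrix.mul_apply, Finset.sum_range]
  rw [h1, Matrix.det_mul_eq_sum_orderEmbedding]
  symm
  -- The increasing enumeration of the shifted parts of `λ`.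
  have hrev : ∀ lam ∈ boxPartitions n M, ∃ g : Fin n ↪o Fin (n + M), ∀ i : Fin n,
      (g (Fin.rev i) : ℕ) = shiftedPart n lam i := by
    intro lam h
    refine ⟨OrderEmbedding.ofStrictMono (fun i => ⟨shiftedPart n lam (Fin.rev i),
      shiftedPart_lt h (Fin.rev i).2⟩) ?_, fun i =>
        congrArg (fun k : Fin n => shiftedPart n lam k) (Fin.rev_rev i)⟩
    intro i j hij
    exact shiftedPart_lt_shiftedPart lam (Fin.rev_lt_rev.2 hij) (Fin.rev i).2
  have : Nonempty (Fin n ↪o Fin (n + M)) := ⟨Fin.castAddOrderEmb M⟩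
  choose! g hg using hrev
  refine Finset.sum_bij (fun lam _ => g lam) (fun _ _ => Finset.mem_univ _) ?_ ?_ ?_
  · intro lam hl mu hm h
    refine eq_of_shiftedPart_eq hl hm fun i => ?_
    rw [← hg lam hl, ← hg mu hm, h]
  · intro f _
    obtain ⟨lam, hl, hs⟩ := exists_shiftedPart_eq (M := M) (fun i : Fin n => (f (Fin.rev i) : ℕ))
      (fun i j hij => f.strictMono (Fin.rev_lt_rev.2 hij)) (fun i => (f _).2)
    refine ⟨lam, hl, ?_⟩
    ext i
    have := hg lam hl (Fin.rev i)
    rw [hs] at this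
    simpa using this
  · intro lam hl
    have ha : (Matrix.of fun i j : Fin n => a i (shiftedPart n lam j)) =
        ((Matrix.of fun (i : Fin n) (k : Fin (n + M)) => a i k).submatrix id (g lam)).submatrix id
          Fin.revPerm := by
      ext i j
      simp [← hg lam hl, -Fin.val_rev]
    have hb : (Matrix.of fun i j : Fin n => b (shiftedPart n lam i) j) =
        ((Matrix.of fun (k : Fin (n + M)) (j : Fin n) => b k j).submatrix (g lam) id).submatrix
          Fin.revPerm id := by
      ext i j
      simp [← hg lam hl, -Fin.val_rev]
    -- Listing the columns of one factor and the rows of the other backwards costs the same sign.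
    rw [ha, hb, Matrix.det_permute', Matrix.det_permute, mul_mul_mul_comm, ← Int.cast_mul,
      ← Units.val_mul, Int.units_mul_self, Units.val_one, Int.cast_one, one_mul]

/-! ### Alternants and Schur polynomials -/

theorem map_alternant {A B : Type*} [CommRing A] [CommRing B] (φ : A →+* B) {n : ℕ}
    (lam : YoungDiagram) (z : Fin n → A) :
    φ (alternant lam z) = alternant lam fun i => φ (z i) := by
  rw [alternant, RingHom.map_det, alternant]
  congr 1
  ext i j
  simp

theorem map_schur {A B : Type*} [CommRing A] [CommRing B] (φ : A →+* B) {n : ℕ}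
    (lam : YoungDiagram) (z : Fin n → A) :
    φ (schur lam z) = schur lam fun i => φ (z i) := by
  have h := MvPolynomial.comp_aeval_apply (f := z) φ.toIntAlgHom (schurPoly n lam)
  exact h

theorem vandermondeProd_mul_schur {A : Type*} [CommRing A] {n : ℕ} {lam : YoungDiagram}
    (h : lam.colLen 0 ≤ n) (z : Fin n → A) :
    vandermondeProd z * schur lam z = alternant lam z := by
  have h1 := congrArg (MvPolynomial.aeval z : MvPolynomial (Fin n) ℤ →ₐ[ℤ] A).toRingHom
    (vandermondeProd_mul_schurPoly n lam h)
  rw [map_mul, map_vandermondeProd, map_alternant] at h1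
  simp only [AlgHom.toRingHom_eq_coe, RingHom.coe_coe, MvPolynomial.aeval_X] at h1
  exact h1

theorem rowLen_bot (i : ℕ) : (⊥ : YoungDiagram).rowLen i = 0 := by
  by_contra h
  exact YoungDiagram.notMem_bot (i, 0) (YoungDiagram.mem_iff_lt_rowLen.2 (by omega))

theorem bot_mem_boxPartitions (L M : ℕ) : (⊥ : YoungDiagram) ∈ boxPartitions L M :=
  mem_boxPartitions_iff_forall.2 fun _ _ h => absurd h (YoungDiagram.notMem_bot _)

/-- The alternant of the empty partition is the Vandermonde product, without a sign. -/
theorem alternant_bot {A : Type*} [CommRing A] {n : ℕ} (z : Fin n → A) :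
    alternant ⊥ z = vandermondeProd z := by
  have h := Matrix.det_projVandermonde (fun _ : Fin n => (1 : A)) z
  simp only [one_mul] at h
  rw [alternant, vandermondeProd, ← h]
  congr 1
  ext i j
  simp only [Matrix.of_apply, Matrix.projVandermonde_apply, rowLen_bot, Fin.val_rev, one_pow,
    one_mul, zero_add]
  congr 1
  omega

theorem vandermondeProd_ne_zero {A : Type*} [CommRing A] [IsDomain A] {n : ℕ} {z : Fin n → A}
    (hz : Function.Injective z) : vandermondeProd z ≠ 0 :=
  Finset.prod_ne_zero_iff.2 fun _ _ => Finset.prod_ne_zero_iff.2 fun _ hj =>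
    sub_ne_zero.2 fun h => (Finset.mem_Ioi.1 hj).ne (hz h)

/-! ### Complementary partitions -/

/-- The complement of `λ` in the `n × M` rectangle, rotated by a half turn: the partition
`(M - λ_n, …, M - λ_1)`. -/
def boxComplement (n M : ℕ) (lam : YoungDiagram) : YoungDiagram where
  cells := (Finset.range n ×ˢ Finset.range M).filter fun c => (n - 1 - c.1, M - 1 - c.2) ∉ lam
  isLowerSet := by
    rintro ⟨i, j⟩ ⟨i', j'⟩ hle h
    obtain ⟨hi, hj⟩ : i' ≤ i ∧ j' ≤ j := hle
    simp only [Finset.coe_filter, Finset.mem_product, Finset.mem_range, Set.mem_ofPred_eq] at h ⊢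
    exact ⟨by omega, fun hc => h.2 (lam.up_left_mem (by omega) (by omega) hc)⟩

theorem mem_boxComplement {n M : ℕ} {lam : YoungDiagram} {i j : ℕ} :
    (i, j) ∈ boxComplement n M lam ↔ (i < n ∧ j < M) ∧ (n - 1 - i, M - 1 - j) ∉ lam := by
  rw [← YoungDiagram.mem_cells]
  simp [boxComplement]

theorem boxComplement_mem_boxPartitions (n M : ℕ) (lam : YoungDiagram) :
    boxComplement n M lam ∈ boxPartitions n M :=
  mem_boxPartitions_iff_forall.2 fun _ _ h => (mem_boxComplement.1 h).1

theorem boxComplement_boxComplement {n M : ℕ} {lam : YoungDiagram} (h : lam ∈ boxPartitions n M) :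
    boxComplement n M (boxComplement n M lam) = lam := by
  ext ⟨i, j⟩
  rw [YoungDiagram.mem_cells, YoungDiagram.mem_cells, mem_boxComplement, mem_boxComplement]
  have h1 := mem_boxPartitions_iff_forall.1 h i j
  by_cases hij : i < n ∧ j < M
  · have h2 : n - 1 - (n - 1 - i) = i := by omega
    have h3 : M - 1 - (M - 1 - j) = j := by omega
    have h4 : n - 1 - i < n ∧ M - 1 - j < M := by omega
    simp [hij, h2, h3, h4]
  · simp only [hij, false_and, false_iff]
    exact fun hc => hij (h1 hc)

theorem transpose_boxComplement (n M : ℕ) (lam : YoungDiagram) :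
    (boxComplement n M lam).transpose = boxComplement M n lam.transpose := by
  ext ⟨i, j⟩
  rw [YoungDiagram.mem_cells, YoungDiagram.mem_cells, YoungDiagram.mem_transpose,
    mem_boxComplement, Prod.swap_prod_mk, mem_boxComplement, YoungDiagram.mem_transpose]
  simp [and_comm]

theorem rowLen_boxComplement {n M : ℕ} (lam : YoungDiagram) {i : ℕ} (hi : i < n) :
    (boxComplement n M lam).rowLen i = M - lam.rowLen (n - 1 - i) := by
  have h1 : ∀ j, j < (boxComplement n M lam).rowLen i ↔ j < M - lam.rowLen (n - 1 - i) := by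
    intro j
    rw [← YoungDiagram.mem_iff_lt_rowLen, mem_boxComplement, YoungDiagram.mem_iff_lt_rowLen]
    omega
  have h2 := h1 ((boxComplement n M lam).rowLen i)
  have h3 := h1 (M - lam.rowLen (n - 1 - i))
  omega

theorem card_eq_sum_rowLen {n M : ℕ} {lam : YoungDiagram} (h : lam ∈ boxPartitions n M) :
    lam.card = ∑ i : Fin n, lam.rowLen i := by
  have h1 : lam.cells = (Finset.univ : Finset (Fin n)).biUnion fun i => lam.row i := by
    ext ⟨i, j⟩
    simp only [Finset.mem_biUnion, Finset.mem_univ, true_and, YoungDiagram.mem_row_iff,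
      YoungDiagram.mem_cells]
    constructor
    · intro hij
      exact ⟨⟨i, (mem_boxPartitions_iff_forall.1 h i j hij).1⟩, hij, rfl⟩
    · rintro ⟨_, hij, _⟩
      exact hij
  rw [YoungDiagram.card, h1, Finset.card_biUnion]
  · simp [YoungDiagram.rowLen_eq_card]
  · intro a _ b _ hab
    rw [Function.onFun, Finset.disjoint_left]
    intro c hc hc'
    exact hab (Fin.ext ((YoungDiagram.mem_row_iff.1 hc).2.symm.trans
      (YoungDiagram.mem_row_iff.1 hc').2))

theorem card_add_card_boxComplement {n M : ℕ} {lam : YoungDiagram} (h : lam ∈ boxPartitions n M) :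
    lam.card + (boxComplement n M lam).card = n * M := by
  rw [card_eq_sum_rowLen h, card_eq_sum_rowLen (boxComplement_mem_boxPartitions n M lam),
    ← Equiv.sum_comp Fin.revPerm (fun i : Fin n => lam.rowLen i), ← Finset.sum_add_distrib]
  have : ∀ i : Fin n, lam.rowLen (Fin.revPerm i) + (boxComplement n M lam).rowLen i = M := by
    intro i
    have h1 := rowLen_le_of_mem_boxPartitions h (n - 1 - i)
    have h2 : ((Fin.revPerm i : Fin n) : ℕ) = n - 1 - i := by
      simp only [Fin.revPerm_apply, Fin.val_rev]; omega
    rw [rowLen_boxComplement lam i.2, h2]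
    omega
  rw [Finset.sum_congr rfl fun i _ => this i]
  simp

/-- The substitution `u_i = -1 / x_i` turns the alternant of the complementary partition into the
alternant of the partition, with its columns in reverse order. -/
theorem prod_pow_mul_alternant_boxComplement {A : Type*} [CommRing A] {n M : ℕ}
    {lam : YoungDiagram} (h : lam ∈ boxPartitions n M) {x u : Fin n → A}
    (hxu : ∀ i, x i * u i = -1) :
    (∏ i, x i ^ (M + (n - 1))) * alternant (boxComplement n M lam) u =
      (-1) ^ (boxComplement n M lam).card * ((-1) ^ (∑ j : Fin n, (n - 1 - (j : ℕ))) *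
        ((Equiv.Perm.sign (Fin.revPerm (n := n)) : ℤ) : A)) * alternant lam x := by
  have hcard : (boxComplement n M lam).card + ∑ j : Fin n, (n - 1 - (j : ℕ)) =
      ∑ j : Fin n, shiftedPart n (boxComplement n M lam) j := by
    rw [card_eq_sum_rowLen (boxComplement_mem_boxPartitions n M lam), ← Finset.sum_add_distrib]
    rfl
  rw [← mul_assoc, ← pow_add, hcard, ← Finset.prod_pow_eq_pow_sum, mul_assoc, alternant, alternant,
    ← Matrix.det_permute', ← Matrix.det_mul_column (fun i => x i ^ (M + (n - 1))),
    ← Matrix.det_mul_row (fun j : Fin n => (-1) ^ shiftedPart n (boxComplement n M lam) j)]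
  congr 1
  ext i j
  have h1 : M + (n - 1) = shiftedPart n lam (Fin.revPerm j : Fin n) +
      shiftedPart n (boxComplement n M lam) j := by
    have h2 := rowLen_le_of_mem_boxPartitions h (n - 1 - j)
    have h3 : ((Fin.revPerm j : Fin n) : ℕ) = n - 1 - j := by
      simp only [Fin.revPerm_apply, Fin.val_rev]; omega
    rw [shiftedPart, shiftedPart, rowLen_boxComplement lam j.2, h3]
    omega
  change x i ^ (M + (n - 1)) * u i ^ shiftedPart n (boxComplement n M lam) j =
    (-1) ^ shiftedPart n (boxComplement n M lam) j *
      x i ^ shiftedPart n lam (Fin.revPerm j : Fin n)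
  rw [h1, pow_add, mul_assoc, ← mul_pow, hxu, mul_comm]

/-- The duality `s_λ(x) = (-1) ^ |λ^c| ∏ x_i ^ M s_{λ^c}(-1/x)` between complementary partitions in
the `n × M` rectangle, at points with distinct coordinates. -/
theorem prod_pow_mul_schur_boxComplement_of_injective {A : Type*} [CommRing A] [IsDomain A]
    {n M : ℕ} {lam : YoungDiagram} (h : lam ∈ boxPartitions n M) {x u : Fin n → A}
    (hx : Function.Injective x) (hxu : ∀ i, x i * u i = -1) :
    (∏ i, x i ^ M) * schur (boxComplement n M lam) u =
      (-1) ^ (boxComplement n M lam).card * schur lam x := by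
  have h1 := prod_pow_mul_alternant_boxComplement h hxu
  -- The empty partition in the `n × 0` rectangle gives the same formula for Vandermonde products.
  have h2 := prod_pow_mul_alternant_boxComplement (bot_mem_boxPartitions n 0) hxu
  have hb : boxComplement n 0 ⊥ = ⊥ := by
    ext ⟨i, j⟩
    rw [YoungDiagram.mem_cells, YoungDiagram.mem_cells, mem_boxComplement]
    simp
  set c : A := (-1) ^ (∑ j : Fin n, (n - 1 - (j : ℕ))) *
    ((Equiv.Perm.sign (Fin.revPerm (n := n)) : ℤ) : A) with hc
  have hc0 : c ≠ 0 := by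
    refine IsUnit.ne_zero ?_
    rw [hc]
    exact (isUnit_one.neg.pow _).mul ((Units.isUnit _).map (Int.castRingHom A))
  rw [hb, alternant_bot, alternant_bot] at h2
  rw [← vandermondeProd_mul_schur
      (mem_boxPartitions.1 (boxComplement_mem_boxPartitions n M lam)).1,
    ← vandermondeProd_mul_schur (mem_boxPartitions.1 h).1] at h1
  simp only [pow_add, Finset.prod_mul_distrib, one_mul, pow_zero,
    YoungDiagram.card, YoungDiagram.cells_bot, Finset.card_empty] at h1 h2
  refine mul_left_cancel₀ (mul_ne_zero hc0 (vandermondeProd_ne_zero hx)) ?_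
  rw [YoungDiagram.card]
  linear_combination h1 - (∏ i, x i ^ M) * schur (boxComplement n M lam) u * h2

/-- The duality between complementary partitions at all points with nonzero coordinates. -/
theorem prod_pow_mul_schur_boxComplement {n M : ℕ} {lam : YoungDiagram}
    (h : lam ∈ boxPartitions n M) {x : Fin n → ℂ} (hx : ∀ i, x i ≠ 0) :
    (∏ i, x i ^ M) * schur (boxComplement n M lam) (dualVar x) =
      (-1) ^ (boxComplement n M lam).card * schur lam x := by
  -- The points `x_i + i t` have distinct coordinates in `ℂ⟦t⟧`; then set `t = 0`.
  let X : Fin n → PowerSeries ℂ := fun i =>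
    PowerSeries.C (x i) + PowerSeries.C ((i : ℕ) : ℂ) * PowerSeries.X
  have hX0 : ∀ i, PowerSeries.constantCoeff (X i) = x i := fun i => by simp [X]
  have hX : Function.Injective X := by
    intro i j hij
    have h1 := congrArg (PowerSeries.coeff 1) hij
    simp only [X, map_add, PowerSeries.coeff_C_mul, PowerSeries.coeff_one_X, PowerSeries.coeff_C,
      one_ne_zero, if_false, zero_add, mul_one] at h1
    exact Fin.ext (by exact_mod_cast h1)
  have h1 := prod_pow_mul_schur_boxComplement_of_injective h hX (u := fun i => -(X i)⁻¹) (by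
    intro i
    rw [mul_neg, PowerSeries.mul_inv_cancel _ (by rw [hX0]; exact hx i)])
  have h2 := congrArg (PowerSeries.constantCoeff (R := ℂ)) h1
  simp only [map_mul, map_prod, map_pow, map_schur, map_neg, map_one, hX0,
    PowerSeries.constantCoeff_inv] at h2
  have h3 : dualVar x = fun i => -(x i)⁻¹ := funext fun i => by
    rw [dualVar, neg_div, one_div]
  rw [h3]
  exact h2

/-! ### Andréief's identity -/

/-- The integrand of Andréief's identity as a linear combination of products of functions of one
variable. -/
theorem det_mul_det_mul_prod_eq_sum {M : ℕ} (f g : Fin M → ℝ → ℝ) (w : ℝ → ℝ) (z : Fin M → ℝ) :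
    (Matrix.of fun i j => f j (z i)).det * (Matrix.of fun i j => g j (z i)).det * ∏ i, w (z i) =
      ∑ σ : Equiv.Perm (Fin M), ∑ τ : Equiv.Perm (Fin M),
        ((Equiv.Perm.sign σ : ℤ) : ℝ) * ((Equiv.Perm.sign τ : ℤ) : ℝ) *
          ∏ i, f (σ i) (z i) * g (τ i) (z i) * w (z i) := by
  rw [← Matrix.det_transpose, ← Matrix.det_transpose (Matrix.of fun i j => g j (z i)),
    Matrix.det_apply', Matrix.det_apply', Finset.sum_mul_sum, Finset.sum_mul]
  refine Finset.sum_congr rfl fun σ _ => ?_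
  rw [Finset.sum_mul]
  refine Finset.sum_congr rfl fun τ _ => ?_
  simp only [Matrix.transpose_apply, Matrix.of_apply, Finset.prod_mul_distrib]
  ring

theorem integrable_det_mul_det_mul_prod {M : ℕ} (f g : Fin M → ℝ → ℝ) (w : ℝ → ℝ)
    (h : ∀ j k, MeasureTheory.Integrable fun t => f j t * g k t * w t) :
    MeasureTheory.Integrable fun z : Fin M → ℝ =>
      (Matrix.of fun i j => f j (z i)).det * (Matrix.of fun i j => g j (z i)).det *
        ∏ i, w (z i) := by
  simp only [det_mul_det_mul_prod_eq_sum]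
  refine MeasureTheory.integrable_finsetSum _ fun σ _ =>
    MeasureTheory.integrable_finsetSum _ fun τ _ => MeasureTheory.Integrable.const_mul ?_ _
  exact MeasureTheory.Integrable.fintype_prod
    (f := fun i t => f (σ i) t * g (τ i) t * w t) fun i => h _ _

/-- **Andréief's identity**. -/
theorem integral_det_mul_det_mul_prod {M : ℕ} (f g : Fin M → ℝ → ℝ) (w : ℝ → ℝ)
    (h : ∀ j k, MeasureTheory.Integrable fun t => f j t * g k t * w t) :
    ∫ z : Fin M → ℝ, (Matrix.of fun i j => f j (z i)).det *
        (Matrix.of fun i j => g j (z i)).det * ∏ i, w (z i) =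
      M.factorial * (Matrix.of fun j k => ∫ t, f j t * g k t * w t).det := by
  have hint : ∀ σ τ : Equiv.Perm (Fin M), MeasureTheory.Integrable fun z : Fin M → ℝ =>
      ((Equiv.Perm.sign σ : ℤ) : ℝ) * ((Equiv.Perm.sign τ : ℤ) : ℝ) *
          ∏ i, f (σ i) (z i) * g (τ i) (z i) * w (z i) := fun σ τ =>
    MeasureTheory.Integrable.const_mul (MeasureTheory.Integrable.fintype_prod
      (f := fun i t => f (σ i) t * g (τ i) t * w t) fun i => h _ _) _
  simp only [det_mul_det_mul_prod_eq_sum]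
  rw [MeasureTheory.integral_finsetSum _ fun σ _ =>
    MeasureTheory.integrable_finsetSum _ fun τ _ => hint σ τ]
  have h1 : ∀ σ : Equiv.Perm (Fin M), ∫ z : Fin M → ℝ, ∑ τ : Equiv.Perm (Fin M),
        ((Equiv.Perm.sign σ : ℤ) : ℝ) * ((Equiv.Perm.sign τ : ℤ) : ℝ) *
          ∏ i, f (σ i) (z i) * g (τ i) (z i) * w (z i) =
      (Matrix.of fun j k => ∫ t, f j t * g k t * w t).det := by
    intro σ
    have h2 : (Matrix.of fun j k => ∫ t, f j t * g k t * w t).det =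
        ((Equiv.Perm.sign σ : ℤ) : ℝ) * ((Matrix.of fun j k =>
          ∫ t, f j t * g k t * w t).submatrix σ id).det := by
      rw [Matrix.det_permute, ← mul_assoc, ← Int.cast_mul, ← Units.val_mul, Int.units_mul_self]
      simp
    rw [MeasureTheory.integral_finsetSum _ fun τ _ => hint σ τ, h2, ← Matrix.det_transpose,
      Matrix.det_apply', Finset.mul_sum]
    refine Finset.sum_congr rfl fun τ _ => ?_
    rw [MeasureTheory.integral_const_mul, MeasureTheory.integral_fintype_prod_volume_eq_prod
      (fun i t => f (σ i) t * g (τ i) t * w t), mul_assoc]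
    rfl
  simp [h1, Fintype.card_perm]

/-! ### Averages as Hankel minors -/

theorem integrable_alternant_mul_alternant {n M : ℕ} {w : ℝ → ℝ}
    (hw : ∀ k ≤ 2 * (n + M) - 2, MeasureTheory.Integrable fun z : ℝ => z ^ k * w z)
    {lam mu : YoungDiagram} (hl : lam ∈ boxPartitions M n) (hm : mu ∈ boxPartitions M n)
    (j k : Fin M) :
    MeasureTheory.Integrable fun t : ℝ =>
      t ^ shiftedPart M lam j * t ^ shiftedPart M mu k * w t := by
  simp only [← pow_add]
  have := shiftedPart_lt hl j.2
  have := shiftedPart_lt hm k.2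
  exact hw _ (by omega)

theorem schur_mul_schur_mul_ensembleDensity {M : ℕ} (w : ℝ → ℝ) {lam mu : YoungDiagram}
    (hl : lam.colLen 0 ≤ M) (hm : mu.colLen 0 ≤ M) (z : Fin M → ℝ) :
    schur lam z * schur mu z * ensembleDensity w M z =
      alternant lam z * alternant mu z * ∏ i, w (z i) := by
  rw [ensembleDensity, ← vandermondeProd_mul_schur hl, ← vandermondeProd_mul_schur hm]
  ring

theorem integrable_schur_mul_schur {n M : ℕ} {w : ℝ → ℝ}
    (hw : ∀ k ≤ 2 * (n + M) - 2, MeasureTheory.Integrable fun z : ℝ => z ^ k * w z)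
    {lam mu : YoungDiagram} (hl : lam ∈ boxPartitions M n) (hm : mu ∈ boxPartitions M n) :
    MeasureTheory.Integrable fun z : Fin M → ℝ =>
      schur lam z * schur mu z * ensembleDensity w M z := by
  simp only [schur_mul_schur_mul_ensembleDensity w (mem_boxPartitions.1 hl).1
    (mem_boxPartitions.1 hm).1]
  exact integrable_det_mul_det_mul_prod (fun j t => t ^ shiftedPart M lam j)
    (fun j t => t ^ shiftedPart M mu j) w (integrable_alternant_mul_alternant hw hl hm)

theorem integral_alternant_mul_alternant {n M : ℕ} {w : ℝ → ℝ}
    (hw : ∀ k ≤ 2 * (n + M) - 2, MeasureTheory.Integrable fun z : ℝ => z ^ k * w z)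
    {lam mu : YoungDiagram} (hl : lam ∈ boxPartitions M n) (hm : mu ∈ boxPartitions M n) :
    ∫ z : Fin M → ℝ, alternant lam z * alternant mu z * ∏ i, w (z i) =
      M.factorial * (Matrix.of fun j k : Fin M =>
        moment w (shiftedPart M lam j + shiftedPart M mu k)).det := by
  have h := integral_det_mul_det_mul_prod (fun (j : Fin M) t => t ^ shiftedPart M lam j)
    (fun j t => t ^ shiftedPart M mu j) w (integrable_alternant_mul_alternant hw hl hm)
  simp only [← pow_add] at h
  exact h

theorem partitionFunction_eq_hankelDet {n M : ℕ} {w : ℝ → ℝ}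
    (hw : ∀ k ≤ 2 * (n + M) - 2, MeasureTheory.Integrable fun z : ℝ => z ^ k * w z) :
    partitionFunction w M = hankelDet w M := by
  have h := integral_alternant_mul_alternant hw (bot_mem_boxPartitions M n)
    (bot_mem_boxPartitions M n)
  have h1 : (Matrix.of fun j k : Fin M =>
      moment w (shiftedPart M ⊥ j + shiftedPart M ⊥ k)).det = hankelDet w M := by
    rw [hankelDet, ← Matrix.det_submatrix_equiv_self Fin.revPerm (Matrix.of fun i j : Fin M => _)]
    congr 1
    ext j k
    simp only [Matrix.of_apply, Matrix.submatrix_apply, shiftedPart, rowLen_bot, Fin.revPerm_apply,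
      Fin.val_rev]
    congr 1
    omega
  rw [h1] at h
  have hf : (M.factorial : ℝ) ≠ 0 := by exact_mod_cast M.factorial_ne_zero
  simp only [partitionFunction, ensembleDensity, pow_two, ← alternant_bot, h]
  field_simp

theorem ensembleAverage_schur_mul_schur {n M : ℕ} {w : ℝ → ℝ}
    (hw : ∀ k ≤ 2 * (n + M) - 2, MeasureTheory.Integrable fun z : ℝ => z ^ k * w z)
    {lam mu : YoungDiagram} (hl : lam ∈ boxPartitions M n) (hm : mu ∈ boxPartitions M n) :
    ensembleAverage w M (fun z => schur lam z * schur mu z) =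
      (Matrix.of fun j k : Fin M =>
        moment w (shiftedPart M lam j + shiftedPart M mu k)).det / hankelDet w M := by
  have hf : (M.factorial : ℝ) ≠ 0 := by exact_mod_cast M.factorial_ne_zero
  simp only [ensembleAverage, schur_mul_schur_mul_ensembleDensity w (mem_boxPartitions.1 hl).1
    (mem_boxPartitions.1 hm).1, integral_alternant_mul_alternant hw hl hm,
    partitionFunction_eq_hankelDet hw]
  rw [div_mul_eq_mul_div, one_mul, mul_div_mul_left _ _ hf]

/-! ### The kernel and the inverse of the Hankel matrix -/

theorem weightInner_eq_sum {N : ℕ} {w : ℝ → ℝ}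
    (hw : ∀ k ≤ 2 * N - 2, MeasureTheory.Integrable fun z : ℝ => z ^ k * w z)
    {p q : Polynomial ℝ} (hp : p.natDegree < N) (hq : q.natDegree < N) :
    weightInner w p q = ∑ k ∈ Finset.range N, ∑ l ∈ Finset.range N,
      p.coeff k * q.coeff l * moment w (k + l) := by
  have h1 : ∀ z : ℝ, p.eval z * q.eval z * w z = ∑ k ∈ Finset.range N, ∑ l ∈ Finset.range N,
      p.coeff k * q.coeff l * (z ^ (k + l) * w z) := by
    intro z
    rw [Polynomial.eval_eq_sum_range' hp, Polynomial.eval_eq_sum_range' hq, Finset.sum_mul_sum,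
      Finset.sum_mul]
    refine Finset.sum_congr rfl fun k _ => ?_
    rw [Finset.sum_mul]
    exact Finset.sum_congr rfl fun l _ => by ring
  have h2 : ∀ k ∈ Finset.range N, ∀ l ∈ Finset.range N, MeasureTheory.Integrable fun z : ℝ =>
      p.coeff k * q.coeff l * (z ^ (k + l) * w z) := fun k hk l hl => by
    rw [Finset.mem_range] at hk hl
    exact (hw _ (by omega)).const_mul _
  simp only [weightInner, h1]
  rw [MeasureTheory.integral_finsetSum _ fun k hk =>
    MeasureTheory.integrable_finsetSum _ fun l hl => h2 k hk l hl]
  refine Finset.sum_congr rfl fun k hk => ?_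
  rw [MeasureTheory.integral_finsetSum _ fun l hl => h2 k hk l hl]
  exact Finset.sum_congr rfl fun l hl => MeasureTheory.integral_const_mul _ _

/-- The lower unitriangular matrix of the coefficients of `P_0, …, P_{N-1}`. -/
def coeffMatrix (P : ℕ → Polynomial ℝ) (N : ℕ) : Matrix (Fin N) (Fin N) ℝ :=
  Matrix.of fun i j => (P i).coeff j

theorem det_coeffMatrix {w : ℝ → ℝ} {N : ℕ} {P : ℕ → Polynomial ℝ}
    (hP : IsMonicOrthogonal w N P) : (coeffMatrix P N).det = 1 := by
  rw [Matrix.det_of_isLowerTriangular]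
  · refine Finset.prod_eq_one fun i _ => ?_
    have h := hP.monic i i.2
    rw [Polynomial.Monic, Polynomial.leadingCoeff, hP.natDegree_eq i i.2] at h
    exact h
  · intro i j hij
    refine Polynomial.coeff_eq_zero_of_natDegree_lt ?_
    rw [hP.natDegree_eq i i.2]
    exact hij

/-- Orthogonality in matrix form: the coefficient matrix diagonalizes the Hankel form. -/
theorem coeffMatrix_mul_hankel_mul_transpose {w : ℝ → ℝ} {N : ℕ} {P : ℕ → Polynomial ℝ}
    (hw : ∀ k ≤ 2 * N - 2, MeasureTheory.Integrable fun z : ℝ => z ^ k * w z)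
    (hP : IsMonicOrthogonal w N P) :
    coeffMatrix P N * (Matrix.of fun i j : Fin N => moment w (i + j)) *
      (coeffMatrix P N).transpose =
    Matrix.diagonal fun j : Fin N => weightInner w (P j) (P j) := by
  ext i j
  have h1 : weightInner w (P i) (P j) = (coeffMatrix P N *
      (Matrix.of fun i j : Fin N => moment w (i + j)) * (coeffMatrix P N).transpose) i j := by
    rw [weightInner_eq_sum hw (by rw [hP.natDegree_eq i i.2]; exact i.2)
      (by rw [hP.natDegree_eq j j.2]; exact j.2), Finset.sum_comm]
    simp only [Matrix.mul_apply, Finset.sum_range, coeffMatrix, Matrix.of_apply,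
      Matrix.transpose_apply, Finset.sum_mul]
    exact Finset.sum_congr rfl fun k _ => Finset.sum_congr rfl fun l _ => by ring
  rw [← h1]
  by_cases hij : i = j
  · rw [hij, Matrix.diagonal_apply_eq]
  · rw [Matrix.diagonal_apply_ne _ hij]
    exact hP.orthogonal i i.2 j j.2 fun h => hij (Fin.ext h)

theorem hankelDet_eq_prod {w : ℝ → ℝ} {N : ℕ} {P : ℕ → Polynomial ℝ}
    (hw : ∀ k ≤ 2 * N - 2, MeasureTheory.Integrable fun z : ℝ => z ^ k * w z)
    (hP : IsMonicOrthogonal w N P) :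
    hankelDet w N = ∏ j ∈ Finset.range N, weightInner w (P j) (P j) := by
  have h := congrArg Matrix.det (coeffMatrix_mul_hankel_mul_transpose hw hP)
  rw [Matrix.det_mul, Matrix.det_mul, Matrix.det_transpose, det_coeffMatrix hP, one_mul, mul_one,
    Matrix.det_diagonal] at h
  rw [hankelDet, h, Finset.prod_range]

/-- The coefficient of `a ^ k b ^ l` in the kernel `K_N(a; b)`. -/
noncomputable def cdCoeff (w : ℝ → ℝ) (P : ℕ → Polynomial ℝ) (N k l : ℕ) : ℝ :=
  ∑ j ∈ Finset.range N, (weightInner w (P j) (P j))⁻¹ * ((P j).coeff k * (P j).coeff l)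

/-- The coefficients of the kernel form the inverse of the Hankel matrix. -/
theorem hankel_mul_cdCoeff {w : ℝ → ℝ} {N : ℕ} {P : ℕ → Polynomial ℝ}
    (hw : ∀ k ≤ 2 * N - 2, MeasureTheory.Integrable fun z : ℝ => z ^ k * w z)
    (hP : IsMonicOrthogonal w N P) (hh : ∀ j < N, weightInner w (P j) (P j) ≠ 0) :
    (Matrix.of fun i j : Fin N => moment w (i + j)) *
      (Matrix.of fun k l : Fin N => cdCoeff w P N k l) = 1 := by
  have hG : (Matrix.of fun k l : Fin N => cdCoeff w P N k l) =
      (coeffMatrix P N).transpose * (Matrix.diagonal fun j : Fin N =>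
        (weightInner w (P j) (P j))⁻¹) * coeffMatrix P N := by
    ext k l
    rw [Matrix.mul_apply]
    simp only [Matrix.mul_diagonal, Matrix.of_apply, cdCoeff, Finset.sum_range, coeffMatrix,
      Matrix.transpose_apply]
    exact Finset.sum_congr rfl fun j _ => by ring
  have h1 : coeffMatrix P N * ((Matrix.of fun i j : Fin N => moment w (i + j)) *
      (coeffMatrix P N).transpose * Matrix.diagonal fun j : Fin N =>
        (weightInner w (P j) (P j))⁻¹) = 1 := by
    rw [← Matrix.mul_assoc, ← Matrix.mul_assoc, coeffMatrix_mul_hankel_mul_transpose hw hP,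
      Matrix.diagonal_mul_diagonal, ← Matrix.diagonal_one]
    congr 1
    funext j
    exact mul_inv_cancel₀ (hh j j.2)
  rw [hG, ← mul_eq_one_comm.1 h1]
  simp only [Matrix.mul_assoc]

theorem cdKernel_eq_sum {w : ℝ → ℝ} {N : ℕ} {P : ℕ → Polynomial ℝ}
    (hP : IsMonicOrthogonal w N P) {A : Type*} [CommRing A] [Algebra ℝ A] (a b : A) :
    cdKernel w P N a b = ∑ k ∈ Finset.range N, a ^ k *
      ∑ l ∈ Finset.range N, algebraMap ℝ A (cdCoeff w P N k l) * b ^ l := by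
  have h1 : ∀ j ∈ Finset.range N, ∀ c : A, Polynomial.aeval c (P j) =
      ∑ k ∈ Finset.range N, algebraMap ℝ A ((P j).coeff k) * c ^ k := by
    intro j hj c
    rw [Finset.mem_range] at hj
    rw [Polynomial.aeval_eq_sum_range' (by rw [hP.natDegree_eq j hj]; exact hj)]
    simp only [Algebra.smul_def]
  have h2 : cdKernel w P N a b = ∑ j ∈ Finset.range N, ∑ k ∈ Finset.range N,
      ∑ l ∈ Finset.range N, a ^ k * (algebraMap ℝ A ((weightInner w (P j) (P j))⁻¹ *
        ((P j).coeff k * (P j).coeff l)) * b ^ l) := by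
    refine Finset.sum_congr rfl fun j hj => ?_
    rw [h1 j hj, h1 j hj, Finset.sum_mul_sum, Finset.smul_sum]
    refine Finset.sum_congr rfl fun k _ => ?_
    rw [Finset.smul_sum]
    refine Finset.sum_congr rfl fun l _ => ?_
    rw [Algebra.smul_def, map_mul, map_mul]
    ring
  rw [h2, Finset.sum_comm]
  refine Finset.sum_congr rfl fun k _ => ?_
  rw [Finset.sum_comm, Finset.mul_sum]
  refine Finset.sum_congr rfl fun l _ => ?_
  rw [cdCoeff, map_sum, Finset.sum_mul, Finset.mul_sum]

/-! ### Expansion of the multi-point kernel -/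

/-- The determinant of kernels as a double sum over partitions: the Cauchy–Binet formula for the
coefficient matrix of the kernel, whose minors are complementary Hankel minors. -/
theorem hankelDet_mul_det_cdKernel {w : ℝ → ℝ} {n M : ℕ} {P : ℕ → Polynomial ℝ}
    (hw : ∀ k ≤ 2 * (n + M) - 2, MeasureTheory.Integrable fun z : ℝ => z ^ k * w z)
    (hP : IsMonicOrthogonal w (n + M) P) (hh : ∀ j < n + M, weightInner w (P j) (P j) ≠ 0)
    {A : Type*} [CommRing A] [Algebra ℝ A] (x y : Fin n → A) :
    algebraMap ℝ A (hankelDet w (n + M)) *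
        (Matrix.of fun i j : Fin n => cdKernel w P (n + M) (x i) (y j)).det =
      ∑ lam ∈ boxPartitions n M, ∑ mu ∈ boxPartitions n M,
        (-1) ^ (lam.card + mu.card) * alternant lam x * alternant mu y *
          algebraMap ℝ A (Matrix.of fun j k : Fin M =>
            moment w (coshiftedPart n lam j + coshiftedPart n mu k)).det := by
  simp only [cdKernel_eq_sum hP]
  rw [det_sum_mul_eq_sum_boxPartitions (fun i k => x i ^ k) (fun k j => ∑ l ∈ Finset.range (n + M),
    algebraMap ℝ A (cdCoeff w P (n + M) k l) * y j ^ l), Finset.mul_sum]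
  refine Finset.sum_congr rfl fun lam hl => ?_
  rw [det_sum_mul_eq_sum_boxPartitions
    (fun i l => algebraMap ℝ A (cdCoeff w P (n + M) (shiftedPart n lam i) l))
    (fun l j => y j ^ l), Finset.mul_sum, Finset.mul_sum]
  refine Finset.sum_congr rfl fun mu hm => ?_
  have h1 := congrArg (algebraMap ℝ A) (det_mul_minor_shiftedPart
    (a := fun i j => moment w (i + j)) (hankel_mul_cdCoeff hw hP hh) hl hm)
  have h2 : (Matrix.of fun i j : Fin M => moment w (coshiftedPart n mu i + coshiftedPart n lam j))
      = (Matrix.of fun j k : Fin M =>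
        moment w (coshiftedPart n lam j + coshiftedPart n mu k)).transpose := by
    ext i j
    simp [add_comm]
  have h3 : (Matrix.of fun i j : Fin n => y j ^ shiftedPart n mu i).det = alternant mu y := by
    rw [← Matrix.det_transpose]
    rfl
  have h4 : (Matrix.of fun i j : Fin n => x i ^ shiftedPart n lam j).det = alternant lam x := rfl
  have h5 : (Matrix.of fun i j : Fin n => algebraMap ℝ A
      (cdCoeff w P (n + M) (shiftedPart n lam i) (shiftedPart n mu j))).det =
      algebraMap ℝ A (Matrix.of fun i j : Fin n =>
        cdCoeff w P (n + M) (shiftedPart n lam i) (shiftedPart n mu j)).det := by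
    rw [RingHom.map_det]
    rfl
  rw [h2, Matrix.det_transpose, map_mul, map_mul, map_pow, map_neg, map_one] at h1
  rw [h3, h4, h5]
  change algebraMap ℝ A (hankelDet w (n + M)) * _ = _ at h1
  linear_combination (alternant lam x * alternant mu y) * h1

/-- The expansion of the multi-point kernel in Schur polynomials of the original variables, cleared of
its denominator. -/
theorem hankelDet_mul_multiKernel {w : ℝ → ℝ} {n M : ℕ} {P : ℕ → Polynomial ℝ}
    (hw : ∀ k ≤ 2 * (n + M) - 2, MeasureTheory.Integrable fun z : ℝ => z ^ k * w z)
    (hP : IsMonicOrthogonal w (n + M) P) (hh : ∀ j < n + M, weightInner w (P j) (P j) ≠ 0)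
    (x y : Fin n → ℂ) :
    ((hankelDet w (n + M) : ℝ) : ℂ) * multiKernel w P (n + M) x y =
      ∑ lam ∈ boxPartitions n M, ∑ mu ∈ boxPartitions n M,
        (-1) ^ (lam.card + mu.card) * schur lam x * schur mu y *
          (((Matrix.of fun j k : Fin M =>
            moment w (coshiftedPart n lam j + coshiftedPart n mu k)).det : ℝ) : ℂ) := by
  -- In the ring of polynomials the Vandermonde products can be cancelled.
  let X : Fin n → MvPolynomial (Fin n ⊕ Fin n) ℝ := fun i => MvPolynomial.X (Sum.inl i)
  let Y : Fin n → MvPolynomial (Fin n ⊕ Fin n) ℝ := fun i => MvPolynomial.X (Sum.inr i)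
  have hX : vandermondeProd X ≠ 0 := vandermondeProd_ne_zero fun i j h =>
    Sum.inl_injective (MvPolynomial.X_injective h)
  have hY : vandermondeProd Y ≠ 0 := vandermondeProd_ne_zero fun i j h =>
    Sum.inr_injective (MvPolynomial.X_injective h)
  have h1 := hankelDet_mul_det_cdKernel hw hP hh X Y
  rw [show (Matrix.of fun i j : Fin n => cdKernel w P (n + M) (X i) (Y j)).det =
    vandermondeProd X * vandermondeProd Y * multiKernelPoly w P (n + M) n from
    (vandermondeProd_dvd_det_cdKernel w P (n + M) X Y).choose_spec] at h1
  have h2 : algebraMap ℝ (MvPolynomial (Fin n ⊕ Fin n) ℝ) (hankelDet w (n + M)) *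
      multiKernelPoly w P (n + M) n = ∑ lam ∈ boxPartitions n M, ∑ mu ∈ boxPartitions n M,
        (-1) ^ (lam.card + mu.card) * schur lam X * schur mu Y *
          algebraMap ℝ _ (Matrix.of fun j k : Fin M =>
            moment w (coshiftedPart n lam j + coshiftedPart n mu k)).det := by
    refine mul_left_cancel₀ (mul_ne_zero hX hY) ?_
    rw [mul_left_comm, h1, Finset.mul_sum]
    refine Finset.sum_congr rfl fun lam hl => ?_
    rw [Finset.mul_sum]
    refine Finset.sum_congr rfl fun mu hm => ?_
    rw [← vandermondeProd_mul_schur (mem_boxPartitions.1 hl).1,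
      ← vandermondeProd_mul_schur (mem_boxPartitions.1 hm).1]
    ring
  have h3 := congrArg (MvPolynomial.aeval (Sum.elim x y) :
    MvPolynomial (Fin n ⊕ Fin n) ℝ →ₐ[ℝ] ℂ) h2
  have hs : ∀ (lam : YoungDiagram) (f : Fin n → MvPolynomial (Fin n ⊕ Fin n) ℝ),
      (MvPolynomial.aeval (Sum.elim x y) : MvPolynomial (Fin n ⊕ Fin n) ℝ →ₐ[ℝ] ℂ) (schur lam f) =
        schur lam fun i => (MvPolynomial.aeval (Sum.elim x y) :
          MvPolynomial (Fin n ⊕ Fin n) ℝ →ₐ[ℝ] ℂ) (f i) := fun lam f =>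
    map_schur (MvPolynomial.aeval (Sum.elim x y) :
      MvPolynomial (Fin n ⊕ Fin n) ℝ →ₐ[ℝ] ℂ).toRingHom lam f
  simp only [map_mul, map_sum, map_pow, map_neg, map_one, hs, X, Y, MvPolynomial.aeval_X,
    Sum.elim_inl, Sum.elim_inr, AlgHom.commutes] at h3
  exact h3

/-- In terms of complementary partitions, the two sequences of shifted parts are exchanged. -/
theorem coshiftedPart_boxComplement {n M : ℕ} {lam : YoungDiagram}
    (h : lam ∈ boxPartitions n M) (j : Fin M) :
    coshiftedPart n (boxComplement n M lam) (Fin.rev j) = shiftedPart M lam.transpose j := by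
  have h1 := rowLen_le_of_mem_boxPartitions (transpose_mem_boxPartitions h) j
  have h2 : M - 1 - (Fin.rev j : ℕ) = j := by
    simp only [Fin.val_rev]; omega
  rw [coshiftedPart, shiftedPart, transpose_boxComplement, rowLen_boxComplement _ (Fin.rev j).2, h2]
  simp only [Fin.val_rev]
  omega

/-- The expansion in the dual variables, with the coefficients written as normalized Hankel minors. It
is the expansion in the original variables with both sums reindexed by complementary partitions. -/
theorem normalizedKernel_eq_sum {w : ℝ → ℝ} {n M : ℕ} {P : ℕ → Polynomial ℝ}
    (hw : ∀ k ≤ 2 * (n + M) - 2, MeasureTheory.Integrable fun z : ℝ => z ^ k * w z)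
    (hP : IsMonicOrthogonal w (n + M) P) (hh : ∀ j < n + M, weightInner w (P j) (P j) ≠ 0)
    (hM : hankelDet w (n + M) = hankelDet w M * ∏ j ∈ Finset.Ico M (n + M),
      weightInner w (P j) (P j))
    (x y : Fin n → ℂ) (hx : ∀ i, x i ≠ 0) (hy : ∀ i, y i ≠ 0) :
    ((∏ j ∈ Finset.Ico M (n + M), weightInner w (P j) (P j) : ℝ) : ℂ) /
      (∏ i, (x i * y i) ^ M) * multiKernel w P (n + M) x y =
      ∑ lam ∈ boxPartitions n M, ∑ mu ∈ boxPartitions n M,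
        schur lam (dualVar x) * schur mu (dualVar y) *
          (((Matrix.of fun j k : Fin M => moment w (shiftedPart M lam.transpose j +
            shiftedPart M mu.transpose k)).det / hankelDet w M : ℝ) : ℂ) := by
  have h0 : hankelDet w (n + M) ≠ 0 := by
    rw [hankelDet_eq_prod hw hP]
    exact Finset.prod_ne_zero_iff.2 fun j hj => hh j (Finset.mem_range.1 hj)
  have h1 := hankelDet_mul_multiKernel hw hP hh x y
  rw [hM, Complex.ofReal_mul] at h1
  have hM0 : ((hankelDet w M : ℝ) : ℂ) ≠ 0 := by
    rw [hM] at h0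
    exact_mod_cast left_ne_zero_of_mul h0
  have hx0 : ∏ i, x i ^ M ≠ 0 := Finset.prod_ne_zero_iff.2 fun i _ => pow_ne_zero _ (hx i)
  have hy0 : ∏ i, y i ^ M ≠ 0 := Finset.prod_ne_zero_iff.2 fun i _ => pow_ne_zero _ (hy i)
  -- The signs cancel, because `|λ| + |λ^c| = n M` for both partitions.
  have hterm : ∀ lam ∈ boxPartitions n M, ∀ mu ∈ boxPartitions n M,
      (-1) ^ ((boxComplement n M lam).card + (boxComplement n M mu).card) *
        schur (boxComplement n M lam) x * schur (boxComplement n M mu) y *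
          (((Matrix.of fun j k : Fin M => moment w (coshiftedPart n (boxComplement n M lam) j +
            coshiftedPart n (boxComplement n M mu) k)).det : ℝ) : ℂ) =
      ((∏ i, x i ^ M) * schur lam (dualVar x)) * ((∏ i, y i ^ M) * schur mu (dualVar y)) *
        (((Matrix.of fun j k : Fin M => moment w (shiftedPart M lam.transpose j +
            shiftedPart M mu.transpose k)).det : ℝ) : ℂ) := by
    intro lam hl mu hm
    have hX := prod_pow_mul_schur_boxComplement (boxComplement_mem_boxPartitions n M lam) hx
    have hY := prod_pow_mul_schur_boxComplement (boxComplement_mem_boxPartitions n M mu) hy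
    rw [boxComplement_boxComplement hl] at hX
    rw [boxComplement_boxComplement hm] at hY
    have hdet : (Matrix.of fun j k : Fin M => moment w (coshiftedPart n (boxComplement n M lam) j +
        coshiftedPart n (boxComplement n M mu) k)).det =
        (Matrix.of fun j k : Fin M => moment w (shiftedPart M lam.transpose j +
            shiftedPart M mu.transpose k)).det := by
      rw [← Matrix.det_submatrix_equiv_self Fin.revPerm]
      congr 1
      ext j k
      simp only [Matrix.submatrix_apply, Matrix.of_apply, Fin.revPerm_apply,
        coshiftedPart_boxComplement hl, coshiftedPart_boxComplement hm]
    have hsign : ((-1 : ℂ)) ^ ((boxComplement n M lam).card + (boxComplement n M mu).card) =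
        (-1) ^ (lam.card + mu.card) := by
      have hc1 := card_add_card_boxComplement hl
      have hc2 := card_add_card_boxComplement hm
      refine neg_one_pow_congr ?_
      have : Even ((boxComplement n M lam).card + (boxComplement n M mu).card +
        (lam.card + mu.card)) := ⟨n * M, by omega⟩
      exact Nat.even_add.1 this
    rw [hX, hY, hdet, hsign, pow_add]
    ring
  have hsum : ∀ F : YoungDiagram → ℂ, ∑ lam ∈ boxPartitions n M, F lam =
      ∑ lam ∈ boxPartitions n M, F (boxComplement n M lam) := fun F =>
    Finset.sum_nbij' (boxComplement n M) (boxComplement n M)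
      (fun lam _ => boxComplement_mem_boxPartitions n M lam)
      (fun lam _ => boxComplement_mem_boxPartitions n M lam)
      (fun _ h => boxComplement_boxComplement h) (fun _ h => boxComplement_boxComplement h)
      (fun _ h => by rw [boxComplement_boxComplement h])
  rw [hsum] at h1
  simp only [hsum (fun mu => (-1) ^ (_ + mu.card) * _ * schur mu y * _)] at h1
  rw [Finset.sum_congr rfl fun lam hl => Finset.sum_congr rfl fun mu hm => hterm lam hl mu hm] at h1
  have h2 : ((∏ j ∈ Finset.Ico M (n + M), weightInner w (P j) (P j) : ℝ) : ℂ) *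
      multiKernel w P (n + M) x y = (∏ i, (x i * y i) ^ M) *
      ∑ lam ∈ boxPartitions n M, ∑ mu ∈ boxPartitions n M,
        schur lam (dualVar x) * schur mu (dualVar y) *
          (((Matrix.of fun j k : Fin M => moment w (shiftedPart M lam.transpose j +
            shiftedPart M mu.transpose k)).det / hankelDet w M : ℝ) : ℂ) := by
    refine mul_left_cancel₀ hM0 ?_
    rw [← mul_assoc, h1, ← mul_assoc, Finset.mul_sum]
    refine Finset.sum_congr rfl fun lam _ => ?_
    rw [Finset.mul_sum]
    refine Finset.sum_congr rfl fun mu _ => ?_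
    simp only [mul_pow, Finset.prod_mul_distrib, Complex.ofReal_div]
    field_simp
  rw [div_mul_eq_mul_div, h2, mul_div_cancel_left₀]
  simp only [mul_pow, Finset.prod_mul_distrib]
  exact mul_ne_zero hx0 hy0

/-! ### The double Schur expansion -/

theorem theorem2p2 (n N : ℕ) (hn : 1 ≤ n) (hnN : n ≤ N) (w : ℝ → ℝ)
    (hw : ∀ k ≤ 2 * N - 2, MeasureTheory.Integrable (fun z : ℝ => z ^ k * w z))
    (P : ℕ → Polynomial ℝ) (hP : IsMonicOrthogonal w N P)
    (hh : ∀ j < N, weightInner w (P j) (P j) ≠ 0) :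
    -- the averages of the expansion are well defined
    (partitionFunction w (N - n) ≠ 0 ∧
      ∀ lam ∈ boxPartitions n (N - n), ∀ mu ∈ boxPartitions n (N - n),
        MeasureTheory.Integrable (fun z : Fin (N - n) → ℝ =>
          schur lam.transpose z * schur mu.transpose z * ensembleDensity w (N - n) z)) ∧
    -- the double Schur expansion
    (∀ x y : Fin n → ℂ, (∀ i, x i ≠ 0) → (∀ i, y i ≠ 0) →
      normalizedKernel w P N x y =
        ∑ lam ∈ boxPartitions n (N - n), ∑ mu ∈ boxPartitions n (N - n),
          schur lam (dualVar x) * schur mu (dualVar y) *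
            ((ensembleAverage w (N - n)
              (fun z => schur lam.transpose z * schur mu.transpose z) : ℝ) : ℂ)) ∧
    -- the coefficients are normalized Hankel minors
    (∀ lam ∈ boxPartitions n (N - n), ∀ mu ∈ boxPartitions n (N - n),
      ensembleAverage w (N - n) (fun z => schur lam.transpose z * schur mu.transpose z) =
        (Matrix.of fun j k : Fin (N - n) => moment w
          ((lam.transpose.rowLen j + (N - n - 1 - j)) +
            (mu.transpose.rowLen k + (N - n - 1 - k)))).det / hankelDet w (N - n)) ∧
    -- the equivalent expansion in Schur polynomials of the original variables
    (∀ x y : Fin n → ℂ,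
      multiKernel w P N x y = 1 / ((hankelDet w N : ℝ) : ℂ) *
        ∑ lam ∈ boxPartitions n (N - n), ∑ mu ∈ boxPartitions n (N - n),
          (-1) ^ (lam.card + mu.card) * schur lam x * schur mu y *
            (((Matrix.of fun j k : Fin (N - n) => moment w
              ((n + j - lam.transpose.rowLen j) +
                (n + k - mu.transpose.rowLen k))).det : ℝ) : ℂ)) := by
  generalize hM : N - n = M
  obtain rfl : N = n + M := by omega
  have hPM : IsMonicOrthogonal w M P :=
    ⟨fun j hj => hP.monic j (by omega), fun j hj => hP.natDegree_eq j (by omega),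
      fun j hj k hk => hP.orthogonal j (by omega) k (by omega)⟩
  have hdetM := hankelDet_eq_prod (fun k hk => hw k (by omega)) hPM
  have hdetN := hankelDet_eq_prod hw hP
  have hM0 : hankelDet w M ≠ 0 := by
    rw [hdetM]
    exact Finset.prod_ne_zero_iff.2 fun j hj => hh j (by have := Finset.mem_range.1 hj; omega)
  have hN0 : hankelDet w (n + M) ≠ 0 := by
    rw [hdetN]
    exact Finset.prod_ne_zero_iff.2 fun j hj => hh j (Finset.mem_range.1 hj)
  have hratio : hankelDet w (n + M) = hankelDet w M * ∏ j ∈ Finset.Ico M (n + M),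
      weightInner w (P j) (P j) := by
    rw [hdetM, hdetN, Finset.prod_range_mul_prod_Ico _ (by omega)]
  have havg : ∀ lam ∈ boxPartitions n M, ∀ mu ∈ boxPartitions n M,
      ensembleAverage w M (fun z => schur lam.transpose z * schur mu.transpose z) =
        (Matrix.of fun j k : Fin M => moment w (shiftedPart M lam.transpose j +
          shiftedPart M mu.transpose k)).det / hankelDet w M := fun lam hl mu hm =>
    ensembleAverage_schur_mul_schur hw (transpose_mem_boxPartitions hl)
      (transpose_mem_boxPartitions hm)
  refine ⟨⟨?_, fun lam hl mu hm => integrable_schur_mul_schur hw (transpose_mem_boxPartitions hl)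
    (transpose_mem_boxPartitions hm)⟩, fun x y hx hy => ?_, havg, fun x y => ?_⟩
  · rw [partitionFunction_eq_hankelDet hw]
    exact hM0
  · rw [normalizedKernel, Nat.add_sub_cancel_left,
      normalizedKernel_eq_sum hw hP hh hratio x y hx hy]
    exact Finset.sum_congr rfl fun lam hl => Finset.sum_congr rfl fun mu hm => by
      rw [havg lam hl mu hm]
  · have hN0' : ((hankelDet w (n + M) : ℝ) : ℂ) ≠ 0 := by exact_mod_cast hN0
    rw [eq_comm, div_mul_eq_mul_div, one_mul, div_eq_iff hN0', mul_comm]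
    exact (hankelDet_mul_multiKernel hw hP hh x y).symm
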